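/- **Setting.** A base station (BS) with $M$ antennas serves $K$ single-antenna users, $K<M$. A fraction $\alpha_{\rm WET}>0$ of each frame is used for downlink energy transfer, a fraction $\alpha_{\rm WIT}>0$ for uplink information transfer, and the rest ($\alpha_{\rm WET}+\alpha_{\rm WIT}<1$) for training; $B>0$ is the bandwidth and $\sigma^2>0$ the noise variance. The channel of user $i$ is ${\bf g}_i=\sqrt{\beta_i}\,{\bf h}_i\in\mathbb C^M$ with $\beta_i>0$, where all entries of ${\bf h}_1,\dots,{\bf h}_K$ are i.i.d. $\mathcal{CN}(0,1)$. *Downlink.* The BS, knowing the channel, sends ${\bf w}_{\rm dl}s$ with ${\bf w}_{\rm dl}=\sum_j\sqrt{\zeta_j}\,{\bf g}_j/\|{\bf g}_j\|$, $\zeta_j>0$, $\sum_j\zeta_j=1$, where $s$ is independent of the channel and $\mathbb E|s|^2=p_{\rm dl}>0$; put $P_{\rm dl}=\alpha_{\rm WET}Bp_{\rm dl}$. Ignoring noise, user $i$ receives $y_i={\bf g}_i^{\rm H}{\bf w}_{\rm dl}s$, with average received energy $\bar\gamma_i=\alpha_{\rm WET}\mathbb E|y_i|^2$. With efficiency $\eta_{\rm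 EH}\in(0,1]$ and thresholds $0<\theta_{\rm act}\le\theta_{\rm sat}<\infty$, the average harvested energy is $$\bar\delta_i=\eta_{\rm EH}\bar\gamma_i\,\mathbb 1\!\left[\tfrac{\theta_{\rm act}}B\le\bar\gamma_i<\tfrac{\theta_{\rm sat}}B\right]+\tfrac{\eta_{\rm EH}\theta_{\rm sat}}B\,\mathbb 1\!\left[\bar\gamma_i\ge\tfrac{\theta_{\rm sat}}B\right].$$ *Uplink.* User $i$ keeps a fraction $\xi_i\in(0,1)$ of the harvested energy for pilots and sends data symbols with average energy $p^i_{\rm ul}=\eta_{\rm PA}(1-\xi_i)\bar\delta_i/\alpha_{\rm WIT}$, where $\eta_{\rm PA}\in(0,1]$. With ${\bf G}=[{\bf g}_1,\dots,{\bf g}_K]$, the BS detects user $i$ with the zero-forcing vector ${\bf a}_i$, the $i$th column of ${\bf G}({\bf G}^{\rm H}{\bf G})^{-1}$, so that $$\mathrm{SINR}_i=\frac{p^i_{\rm ul}|{\bf a}_i^{\rm H}{\bf g}_i|^2}{\sum_{j\ne i}p^j_{\rm ul}|{\bf a}_i^{\rm H}{\bf g}_j|^2+\sigma^2\|{\bf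 a}_i\|^2}.$$ The ergodic rate of user $i$ is $\mathbb E[\alpha_{\rm WIT}B\log_2(1+\mathrm{SINR}_i)]$. Its achievable rate is the Jensen bound $R_i=\alpha_{\rm WIT}B\log_2\!\big(1+1/\mathbb E[1/\mathrm{SINR}_i]\big)$, with $1/0=\infty$ and $1/\infty=0$. Let $$M_{{\rm act},i}=\Big\lceil1+\tfrac1{\zeta_i}\Big(\tfrac{\theta_{\rm act}}{\beta_iP_{\rm dl}}-1\Big)\Big\rceil,\qquad M_{{\rm sat},i}=\Big\lceil1+\tfrac1{\zeta_i}\Big(\tfrac{\theta_{\rm sat}}{\beta_iP_{\rm dl}}-1\Big)\Big\rceil .$$ **Lemma.** For every user $i$, $\mathbb E|y_i|^2$ is finite and $\bar\gamma_i=\alpha_{\rm WET}p_{\rm dl}\beta_i(\zeta_iM+1-\zeta_i)$; the ergodic rate of user $i$ is finite and at least $R_i$; and $$R_i=\begin{cases}0,&M<M_{{\rm act},i},\\[2pt] \alpha_{\rm WIT}B\log_2\!\Big(1+(1-\xi_i)\beta_i\,\eta_{\rm PA}\dfrac{\eta_{\rm EH}\bar\gamma_i}{\alpha_{\rm WIT}\sigma^2}(M-K)\Big),&M_{{\rm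 act},i}\le M<M_{{\rm sat},i},\\[6pt] \alpha_{\rm WIT}B\log_2\!\Big(1+(1-\xi_i)\beta_i\,\eta_{\rm PA}\dfrac{\eta_{\rm EH}\theta_{\rm sat}}{B\alpha_{\rm WIT}\sigma^2}(M-K)\Big),&M\ge M_{{\rm sat},i}.\end{cases}$$ If $\zeta_i=\frac1K$ and $M_{{\rm act},i}\le M<M_{{\rm sat},i}$, then $R_i=\alpha_{\rm WIT}B\log_2\!\big(1+\rho_i(M-K)\big(1+\tfrac{M-1}K\big)\big)$, where $$\rho_i=\frac{(1-\xi_i)\,p_{\rm dl}\,\alpha_{\rm WET}\,\eta_{\rm EH}\,\eta_{\rm PA}\,\beta_i^2}{\alpha_{\rm WIT}\sigma^2}=\frac{P_{\rm dl}(1-\xi_i)\,\eta_{\rm EH}\,\eta_{\rm PA}\,\beta_i^2}{B\,\alpha_{\rm WIT}\sigma^2}.$$ -/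

import Mathlib

open MeasureTheory ProbabilityTheory

namespace WirelessPower

/-- The law `CN(0,1)` on `ℂ`: independent real and imaginary parts, each `N(0, 1/2)`. -/
noncomputable def stdComplexGaussian : Measure ℂ :=
  ((gaussianReal 0 (1 / 2)).prod (gaussianReal 0 (1 / 2))).map
    (fun p : ℝ × ℝ => (⟨p.1, p.2⟩ : ℂ))

/-- Numerical parameters of a wireless-powered system with `K` users (data only). -/
structure Params (K : ℕ) where
  /-- system bandwidth -/
  B : ℝ
  /-- fraction of the frame used for downlink wireless energy transfer -/
  αWET : ℝ
  /-- fraction of the frame used for uplink wireless information transfer -/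
  αWIT : ℝ
  /-- average downlink transmit symbol energy (joules/symbol) -/
  pdl : ℝ
  /-- noise variance `σ²` at the base station -/
  σ2 : ℝ
  /-- harvester activation threshold (watts) -/
  θact : ℝ
  /-- harvester saturation threshold (watts) -/
  θsat : ℝ
  /-- rectifier efficiency of the harvester -/
  ηEH : ℝ
  /-- power amplifier efficiency at the users -/
  ηPA : ℝ
  /-- fraction of the downlink transmit energy allocated to each user -/
  ζ : Fin K → ℝ
  /-- large-scale channel gain of each user -/
  β : Fin K → ℝ
  /-- fraction of the harvested energy that each user reserves for pilots -/
  ξ : Fin K → ℝ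

variable {M K : ℕ} {Ω : Type*}

/-- Average downlink transmit power `P_dl = α_WET B p_dl` (watts). -/
noncomputable def Params.Pdl (P : Params K) : ℝ := P.αWET * P.B * P.pdl

/-- The channel vector `g_i = √β_i h_i`, where `h i j` is the small-scale fading coefficient
between user `i` and antenna `j`. -/
noncomputable def chan (P : Params K) (h : Fin K → Fin M → Ω → ℂ) (i : Fin K) (ω : Ω) :
    EuclideanSpace ℂ (Fin M) :=
  WithLp.toLp 2 fun j => (Real.sqrt (P.β i) : ℂ) * h i j ω

/-- The downlink precoder `w_dl = ∑ j, √ζ_j g_j / ‖g_j‖`. -/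
noncomputable def precoder (P : Params K) (h : Fin K → Fin M → Ω → ℂ) (ω : Ω) :
    EuclideanSpace ℂ (Fin M) :=
  ∑ j, ((Real.sqrt (P.ζ j) / ‖chan P h j ω‖ : ℝ) : ℂ) • chan P h j ω

/-- The (noise-free) signal `y_i = g_iᴴ w_dl s` received by user `i` on the downlink. -/
noncomputable def rxSignal (P : Params K) (h : Fin K → Fin M → Ω → ℂ) (s : Ω → ℂ)
    (i : Fin K) (ω : Ω) : ℂ :=
  inner ℂ (chan P h i ω) (precoder P h ω) * s ω

/-- Average received energy `γ̄_i = α_WET 𝔼|y_i|²`. -/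
noncomputable def rxEnergy [MeasurableSpace Ω] (μ : Measure Ω) (P : Params K)
    (h : Fin K → Fin M → Ω → ℂ) (s : Ω → ℂ) (i : Fin K) : ℝ :=
  P.αWET * ∫ ω, ‖rxSignal P h s i ω‖ ^ 2 ∂μ

/-- Average energy harvested from an average incident energy `γ`, for the piecewise linear
harvester: nothing below activation, linear up to saturation, constant afterwards. -/
noncomputable def harvest (P : Params K) (γ : ℝ) : ℝ :=
  Set.indicator (Set.Ico (P.θact / P.B) (P.θsat / P.B)) (fun x => P.ηEH * x) γ
    + Set.indicator (Set.Ici (P.θsat / P.B)) (fun _ => P.ηEH * P.θsat / P.B) γ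

/-- Uplink data symbol energy of user `i`, drawn from the harvested energy. -/
noncomputable def ulEnergy [MeasurableSpace Ω] (μ : Measure Ω) (P : Params K)
    (h : Fin K → Fin M → Ω → ℂ) (s : Ω → ℂ) (i : Fin K) : ℝ :=
  P.ηPA * (1 - P.ξ i) * harvest P (rxEnergy μ P h s i) / P.αWIT

/-- The channel matrix `G = [g_1, …, g_K]`. -/
noncomputable def chanMatrix (P : Params K) (h : Fin K → Fin M → Ω → ℂ) (ω : Ω) :
    Matrix (Fin M) (Fin K) ℂ :=
  Matrix.of fun j i => chan P h i ω j

/-- The zero-forcing receive vector of user `i`: the `i`-th column of `G (Gᴴ G)⁻¹`. -/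
noncomputable def zfVector (P : Params K) (h : Fin K → Fin M → Ω → ℂ) (i : Fin K) (ω : Ω) :
    EuclideanSpace ℂ (Fin M) :=
  WithLp.toLp 2 fun j =>
    (chanMatrix P h ω * ((chanMatrix P h ω).conjTranspose * chanMatrix P h ω)⁻¹) j i

/-- Uplink signal-to-interference-plus-noise ratio of user `i` after zero-forcing detection, when
the users transmit with symbol energies `p`:
`p_i |a_iᴴ g_i|² / (∑_{j ≠ i} p_j |a_iᴴ g_j|² + σ² ‖a_i‖²)`. -/
noncomputable def sinr (P : Params K) (h : Fin K → Fin M → Ω → ℂ) (p : Fin K → ℝ)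
    (i : Fin K) (ω : Ω) : ℝ :=
  p i * ‖inner ℂ (zfVector P h i ω) (chan P h i ω)‖ ^ 2 /
    (∑ j ∈ Finset.univ.erase i, p j * ‖inner ℂ (zfVector P h i ω) (chan P h j ω)‖ ^ 2
      + P.σ2 * ‖zfVector P h i ω‖ ^ 2)

/-- Uplink rate of user `i` for the current channel realization. -/
noncomputable def instRate [MeasurableSpace Ω] (μ : Measure Ω) (P : Params K)
    (h : Fin K → Fin M → Ω → ℂ) (s : Ω → ℂ) (i : Fin K) (ω : Ω) : ℝ :=
  P.αWIT * P.B * Real.logb 2 (1 + sinr P h (ulEnergy μ P h s) i ω)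

/-- Ergodic uplink rate of user `i`. -/
noncomputable def ergodicRate [MeasurableSpace Ω] (μ : Measure Ω) (P : Params K)
    (h : Fin K → Fin M → Ω → ℂ) (s : Ω → ℂ) (i : Fin K) : ℝ :=
  ∫ ω, instRate μ P h s i ω ∂μ

/-- The uplink achievable rate `R_i = α_WIT B log₂ (1 + 1 / 𝔼[1 / SINR_i])`, that is, Jensen's bound
for the convex function `x ↦ log₂ (1 + 1 / x)` at `x = 1 / SINR_i`. The inner expectation is taken
in `[0, ∞]`, so that a vanishing SINR gives `1 / 𝔼[1 / SINR_i] = 1 / ∞ = 0`. -/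
noncomputable def achievableRate [MeasurableSpace Ω] (μ : Measure Ω) (P : Params K)
    (h : Fin K → Fin M → Ω → ℂ) (s : Ω → ℂ) (i : Fin K) : ℝ :=
  P.αWIT * P.B * Real.logb 2
    (1 + (∫⁻ ω, (ENNReal.ofReal (sinr P h (ulEnergy μ P h s) i ω))⁻¹ ∂μ)⁻¹.toReal)

/-- Number of antennas needed to bring the average received power of user `i` to the level `θ`. -/
noncomputable def antennaThreshold (P : Params K) (θ : ℝ) (i : Fin K) : ℤ :=
  ⌈1 + 1 / P.ζ i * (θ / (P.β i * P.Pdl) - 1)⌉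

/-- `M_{act,i}`. -/
noncomputable def Mact (P : Params K) (i : Fin K) : ℤ := antennaThreshold P P.θact i

/-- `M_{sat,i}`. -/
noncomputable def Msat (P : Params K) (i : Fin K) : ℤ := antennaThreshold P P.θsat i

/-- `ρ_i`. -/
noncomputable def rho (P : Params K) (i : Fin K) : ℝ :=
  (1 - P.ξ i) * P.pdl * P.αWET * P.ηEH * P.ηPA * P.β i ^ 2 / (P.αWIT * P.σ2)

end WirelessPower

namespace WirelessPower

/-! The computation rests on the unitary invariance of standard complex Gaussian vectors
(`map_inner_orthonormal`): their characteristic function depends only on the norm of its argument.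

Uplink. Zero forcing makes aᵢᴴgⱼ = δᵢⱼ, so the interference vanishes and 1/SINRᵢ = σ²‖aᵢ‖²/pᵢ.
Geometrically, 1/‖aᵢ‖ is the distance of gᵢ to the span of the other channels. Given those, this
span is a fixed subspace, almost surely of codimension M - K + 1. By invariance the squared distance
is βᵢ times the squared norm of a Gaussian vector in dimension M - K + 1, whose inverse has mean
1/(M - K). Hence 𝔼‖aᵢ‖² = 1/(βᵢ(M - K)) (`lintegral_norm_zfVector_sq`), which gives the rate
formula. Jensen's inequality compares it with the ergodic rate, which is finite because 1/‖aᵢ‖² ≤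
‖gᵢ‖².

Downlink. Expanding |gᵢᴴw|² over the beams, cross terms vanish by sign symmetry. The beam aimed at
user i contributes 𝔼‖hᵢ‖² = M, and every other beam, an independent unit vector, contributes 1
(`integral_beamforming`). The received energy is then compared with the harvester thresholds, which
are equivalent to the antenna counts (`lt_antennaThreshold_iff`). -/

/-! ### Standard complex Gaussian vectors and their invariances -/

lemma measurable_complex_mk : Measurable (fun p : ℝ × ℝ => (⟨p.1, p.2⟩ : ℂ)) :=
  Complex.measurableEquivRealProd.symm.measurable

instance : IsProbabilityMeasure stdComplexGaussian :=
  Measure.isProbabilityMeasure_map measurable_complex_mk.aemeasurable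

/-- An integral against `CN(0,1)` of a product of functions of the real and imaginary parts. -/
lemma integral_stdComplexGaussian_mul {𝕜 : Type*} [RCLike 𝕜] {F : ℂ → 𝕜} {f g : ℝ → 𝕜}
    (hF : Continuous F) (h : ∀ z, F z = f z.re * g z.im) :
    ∫ z, F z ∂stdComplexGaussian
      = (∫ x, f x ∂gaussianReal 0 (1 / 2)) * ∫ x, g x ∂gaussianReal 0 (1 / 2) := by
  rw [stdComplexGaussian, integral_map measurable_complex_mk.aemeasurable
    hF.aestronglyMeasurable, ← integral_prod_mul]
  simp [h]

lemma charFun_stdComplexGaussian (t : ℂ) :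
    charFun stdComplexGaussian t = Complex.exp (-(‖t‖ ^ 2 / 4 : ℝ)) := by
  rw [charFun_apply, integral_stdComplexGaussian_mul
    (f := fun x => Complex.exp (t.re * x * Complex.I))
    (g := fun x => Complex.exp (t.im * x * Complex.I)) (by fun_prop)]
  · rw [← charFun_apply_real, ← charFun_apply_real, charFun_gaussianReal, charFun_gaussianReal,
      ← Complex.exp_add, Complex.sq_norm, Complex.normSq_apply]
    congr 1
    push_cast
    ring
  · intro z
    rw [← Complex.exp_add, Complex.inner]
    congr 1
    simp
    ring

/-- The law of a vector of `n` i.i.d. `CN(0,1)` coefficients. -/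
noncomputable def stdComplexGaussianVec (n : ℕ) : Measure (EuclideanSpace ℂ (Fin n)) :=
  (Measure.pi fun _ => stdComplexGaussian).map (WithLp.toLp 2)

lemma measurable_toLp_complex (n : ℕ) :
    Measurable (WithLp.toLp 2 : (Fin n → ℂ) → EuclideanSpace ℂ (Fin n)) :=
  (MeasurableEquiv.toLp 2 (Fin n → ℂ)).measurable

instance (n : ℕ) : IsProbabilityMeasure (stdComplexGaussianVec n) :=
  Measure.isProbabilityMeasure_map (measurable_toLp_complex n).aemeasurable

lemma charFun_stdComplexGaussianVec {n : ℕ} (t : EuclideanSpace ℂ (Fin n)) :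
    charFun (stdComplexGaussianVec n) t = Complex.exp (-(‖t‖ ^ 2 / 4 : ℝ)) := by
  rw [stdComplexGaussianVec, charFun_pi]
  simp only [charFun_stdComplexGaussian]
  rw [← Complex.exp_sum, EuclideanSpace.norm_sq_eq, Finset.sum_div]
  simp

lemma measurable_toLp_inner {M n : ℕ} (e : Fin n → EuclideanSpace ℂ (Fin M)) :
    Measurable (fun x : EuclideanSpace ℂ (Fin M) =>
      (WithLp.toLp 2 fun k => inner ℂ (e k) x : EuclideanSpace ℂ (Fin n))) :=
  (measurable_toLp_complex n).comp (by fun_prop)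

/-- Unitary invariance: the coefficients of a standard complex Gaussian vector along an orthonormal
family are again i.i.d. `CN(0,1)`. -/
lemma map_inner_orthonormal {M n : ℕ} {e : Fin n → EuclideanSpace ℂ (Fin M)}
    (he : Orthonormal ℂ e) :
    (stdComplexGaussianVec M).map (fun x => WithLp.toLp 2 fun k => inner ℂ (e k) x)
      = stdComplexGaussianVec n := by
  have hmeas := measurable_toLp_inner e
  have : IsProbabilityMeasure ((stdComplexGaussianVec M).map
      (fun x => (WithLp.toLp 2 fun k => inner ℂ (e k) x : EuclideanSpace ℂ (Fin n)))) :=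
    Measure.isProbabilityMeasure_map hmeas.aemeasurable
  refine Measure.ext_of_charFun (funext fun t => ?_)
  -- Orthonormality gives ∑ tₖeₖ the length of t, and the characteristic functions depend on length
  -- alone.
  have hnorm : ‖∑ k, t k • e k‖ ^ 2 = ‖t‖ ^ 2 := by
    have := he.inner_sum (fun k => t k) (fun k => t k) Finset.univ
    rw [inner_self_eq_norm_sq_to_K] at this
    rw [EuclideanSpace.norm_sq_eq t]
    have h2 : ∀ k, (starRingEnd ℂ) (t k) * t k = ((‖t k‖ ^ 2 : ℝ) : ℂ) := fun k => by
      rw [Complex.conj_mul']; norm_cast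
    simp only [h2, ← Complex.ofReal_sum] at this
    exact Complex.ofReal_injective (by rw [← this]; simp)
  rw [charFun_stdComplexGaussianVec, ← hnorm, ← charFun_stdComplexGaussianVec, charFun_apply,
    charFun_apply, integral_map hmeas.aemeasurable (by fun_prop)]
  refine integral_congr_ae (ae_of_all _ fun x => ?_)
  have : (inner ℝ (WithLp.toLp 2 fun k => inner ℂ (e k) x : EuclideanSpace ℂ (Fin n)) t : ℝ)
      = inner ℝ x (∑ k, t k • e k) := by
    have hre : ∀ (m : ℕ) (a b : EuclideanSpace ℂ (Fin m)),
        (inner ℝ a b : ℝ) = (inner ℂ a b : ℂ).re := by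
      intro m a b
      simp [PiLp.inner_apply, Complex.inner]
    rw [hre, hre]
    congr 1
    rw [inner_sum, PiLp.inner_apply]
    refine Finset.sum_congr rfl fun k _ => ?_
    rw [inner_smul_right, ← inner_conj_symm x (e k)]
    simp
  simp only [this]

lemma measurePreserving_neg_stdComplexGaussianVec (n : ℕ) :
    MeasurePreserving (fun x => -x) (stdComplexGaussianVec n) (stdComplexGaussianVec n) := by
  refine ⟨measurable_neg, ?_⟩
  have : IsProbabilityMeasure ((stdComplexGaussianVec n).map (fun x => -x)) :=
    Measure.isProbabilityMeasure_map measurable_neg.aemeasurable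
  refine Measure.ext_of_charFun (funext fun t => ?_)
  have h := charFun_map_smul (μ := stdComplexGaussianVec n) (-1) t
  simp only [neg_smul, one_smul] at h
  rw [h, charFun_stdComplexGaussianVec, charFun_stdComplexGaussianVec, norm_neg]

/-! ### Laplace transform and inverse moment of the squared norm -/

lemma integral_exp_neg_sq_gaussianReal {t : ℝ} (ht : 0 ≤ t) :
    ∫ x, Real.exp (-t * x ^ 2) ∂gaussianReal 0 (1 / 2) = Real.sqrt (1 / (1 + t)) := by
  rw [integral_gaussianReal_eq_integral_smul (by norm_num)]
  have : ∀ x : ℝ, gaussianPDFReal 0 (1 / 2) x • Real.exp (-t * x ^ 2)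
      = (Real.sqrt Real.pi)⁻¹ * Real.exp (-(1 + t) * x ^ 2) := by
    intro x
    rw [gaussianPDFReal_def]
    simp only [smul_eq_mul]
    rw [mul_assoc, ← Real.exp_add]
    congr 2
    · congr 1
      push_cast
      ring
    · push_cast
      ring
  simp only [this]
  rw [integral_const_mul, integral_gaussian, ← Real.sqrt_inv, ← Real.sqrt_mul (by positivity)]
  congr 1
  have := Real.pi_pos
  field_simp

lemma integral_exp_neg_norm_sq_stdComplexGaussian {t : ℝ} (ht : 0 ≤ t) :
    ∫ z, Real.exp (-t * ‖z‖ ^ 2) ∂stdComplexGaussian = 1 / (1 + t) := by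
  rw [integral_stdComplexGaussian_mul (f := fun x => Real.exp (-t * x ^ 2))
    (g := fun x => Real.exp (-t * x ^ 2)) (by fun_prop)]
  · rw [integral_exp_neg_sq_gaussianReal ht, Real.mul_self_sqrt (by positivity)]
  · intro z
    rw [← Real.exp_add, Complex.sq_norm, Complex.normSq_apply]
    ring_nf

lemma integral_exp_neg_norm_sq_stdComplexGaussianVec {n : ℕ} {t : ℝ} (ht : 0 ≤ t) :
    ∫ x, Real.exp (-t * ‖x‖ ^ 2) ∂stdComplexGaussianVec n = (1 / (1 + t)) ^ n := by
  rw [stdComplexGaussianVec, integral_map (measurable_toLp_complex n).aemeasurable (by fun_prop)]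
  simp only [EuclideanSpace.norm_sq_eq, Finset.mul_sum, Real.exp_sum]
  rw [integral_fintype_prod_eq_pow (fun z : ℂ => Real.exp (-t * ‖z‖ ^ 2)),
    integral_exp_neg_norm_sq_stdComplexGaussian ht, Fintype.card_fin]

/-- Stated in `ENNReal` so that a = 0 is included: both sides are then ∞. -/
lemma lintegral_exp_neg_mul {a : ℝ} (ha : 0 ≤ a) :
    ∫⁻ t in Set.Ioi (0 : ℝ), ENNReal.ofReal (Real.exp (-t * a)) = (ENNReal.ofReal a)⁻¹ := by
  rcases ha.eq_or_lt with rfl | ha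
  · simp
  · rw [← ofReal_integral_eq_lintegral_ofReal]
    · have h := integral_exp_mul_Ioi (a := -a) (by linarith) 0
      have h2 : ∀ t : ℝ, -t * a = -a * t := fun t => by ring
      simp only [h2]
      rw [h, ← ENNReal.ofReal_inv_of_pos ha]
      simp
    · have := exp_neg_integrableOn_Ioi 0 ha
      refine this.congr (ae_of_all _ fun t => ?_)
      simp only
      ring_nf
    · exact ae_of_all _ fun t => (Real.exp_pos _).le

lemma lintegral_one_div_one_add_pow {n : ℕ} (hn : 2 ≤ n) :
    ∫⁻ t in Set.Ioi (0 : ℝ), ENNReal.ofReal ((1 / (1 + t)) ^ n)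
      = ENNReal.ofReal (1 / ((n : ℝ) - 1)) := by
  have hn' : (2 : ℝ) ≤ n := by exact_mod_cast hn
  have hE : Set.EqOn (fun t : ℝ => (t + 1) ^ (-(n : ℝ))) (fun t => (1 / (1 + t)) ^ n)
      (Set.Ioi 0) := by
    intro t ht
    have ht : (0 : ℝ) < t := ht
    simp only
    rw [Real.rpow_neg (by linarith), Real.rpow_natCast, one_div, inv_pow, add_comm]
  have hint : IntegrableOn (fun t : ℝ => (t + 1) ^ (-(n : ℝ))) (Set.Ioi 0) :=
    integrableOn_add_rpow_Ioi_of_lt (by linarith) (by norm_num)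
  have hshift : ∫ t in Set.Ioi (0 : ℝ), (t + 1) ^ (-(n : ℝ))
      = ∫ t in Set.Ioi (1 : ℝ), t ^ (-(n : ℝ)) := by
    simpa using (measurePreserving_add_right volume (1 : ℝ)).setIntegral_preimage_emb
      (measurableEmbedding_addRight 1) (fun t => t ^ (-(n : ℝ))) (Set.Ioi 1)
  rw [← ofReal_integral_eq_lintegral_ofReal]
  · rw [← setIntegral_congr_fun measurableSet_Ioi hE,
      hshift, integral_Ioi_rpow_of_lt (by linarith) (by norm_num)]
    congr 1
    rw [Real.one_rpow, neg_div, ← div_neg]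
    congr 1
    ring
  · exact hint.congr_fun hE measurableSet_Ioi
  · filter_upwards [ae_restrict_mem measurableSet_Ioi] with t ht
    have ht : (0 : ℝ) < t := ht
    positivity

/-- The inverse of the squared norm of a standard complex Gaussian vector (a `Gamma(n, 1)`
variable) has expectation `1 / (n - 1)`. -/
lemma lintegral_inv_norm_sq_stdComplexGaussianVec {n : ℕ} (hn : 2 ≤ n) :
    ∫⁻ x, (ENNReal.ofReal (‖x‖ ^ 2))⁻¹ ∂stdComplexGaussianVec n
      = ENNReal.ofReal (1 / ((n : ℝ) - 1)) := by
  -- Write 1/y = ∫ e^(-ty) dt and apply Tonelli: the Laplace transform of ‖x‖² is (1 + t)⁻ⁿ,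
  -- integrable at infinity because n ≥ 2.
  simp only [← lintegral_exp_neg_mul (sq_nonneg _)]
  rw [lintegral_lintegral_swap (by fun_prop), ← lintegral_one_div_one_add_pow hn]
  refine setLIntegral_congr_fun measurableSet_Ioi fun t ht => ?_
  have ht : (0 : ℝ) < t := ht
  rw [← integral_exp_neg_norm_sq_stdComplexGaussianVec ht.le, ofReal_integral_eq_lintegral_ofReal]
  · refine (integrable_const (1 : ℝ)).mono' (by fun_prop) (ae_of_all _ fun x => ?_)
    rw [Real.norm_eq_abs, Real.abs_exp, Real.exp_le_one_iff]
    nlinarith [sq_nonneg ‖x‖]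
  · exact ae_of_all _ fun x => (Real.exp_pos _).le

/-! ### Second moments -/

lemma integral_sq_gaussianReal : ∫ x, x ^ 2 ∂gaussianReal 0 (1 / 2) = 1 / 2 := by
  have h := variance_fun_id_gaussianReal (μ := 0) (v := 1 / 2)
  rw [variance_of_integral_eq_zero (by fun_prop) (by simp)] at h
  simpa using h

lemma integrable_sq_gaussianReal : Integrable (fun x => x ^ 2) (gaussianReal 0 (1 / 2)) :=
  (memLp_id_gaussianReal 2).integrable_sq

lemma norm_sq_complex_mk (p : ℝ × ℝ) : ‖(⟨p.1, p.2⟩ : ℂ)‖ ^ 2 = p.1 ^ 2 + p.2 ^ 2 := by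
  rw [Complex.sq_norm, Complex.normSq_apply]
  ring

lemma integrable_norm_sq_stdComplexGaussian :
    Integrable (fun z => ‖z‖ ^ 2) stdComplexGaussian := by
  rw [stdComplexGaussian, integrable_map_measure (by fun_prop) measurable_complex_mk.aemeasurable]
  simp only [Function.comp_def, norm_sq_complex_mk]
  exact (integrable_sq_gaussianReal.comp_fst _).add (integrable_sq_gaussianReal.comp_snd _)

lemma integral_norm_sq_stdComplexGaussian : ∫ z, ‖z‖ ^ 2 ∂stdComplexGaussian = 1 := by
  rw [stdComplexGaussian, integral_map measurable_complex_mk.aemeasurable (by fun_prop)]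
  simp only [norm_sq_complex_mk]
  rw [integral_add (integrable_sq_gaussianReal.comp_fst _) (integrable_sq_gaussianReal.comp_snd _),
    integral_fun_fst (fun x : ℝ => x ^ 2),
    integral_fun_snd (fun x : ℝ => x ^ 2), integral_sq_gaussianReal]
  norm_num

lemma integrable_norm_sq_stdComplexGaussianVec (n : ℕ) :
    Integrable (fun x => ‖x‖ ^ 2) (stdComplexGaussianVec n) := by
  rw [stdComplexGaussianVec, integrable_map_measure (by fun_prop)
    (measurable_toLp_complex n).aemeasurable]
  simp only [Function.comp_def, EuclideanSpace.norm_sq_eq]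
  exact integrable_finsetSum _ fun k _ =>
    integrable_comp_eval (μ := fun _ : Fin n => stdComplexGaussian)
      (f := fun z : ℂ => ‖z‖ ^ 2) integrable_norm_sq_stdComplexGaussian

lemma integral_norm_sq_stdComplexGaussianVec (n : ℕ) :
    ∫ x, ‖x‖ ^ 2 ∂stdComplexGaussianVec n = n := by
  rw [stdComplexGaussianVec, integral_map (measurable_toLp_complex n).aemeasurable (by fun_prop)]
  simp only [EuclideanSpace.norm_sq_eq]
  rw [integral_finsetSum _ fun k _ =>
    integrable_comp_eval (μ := fun _ : Fin n => stdComplexGaussian)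
      (f := fun z : ℂ => ‖z‖ ^ 2) integrable_norm_sq_stdComplexGaussian]
  simp only [integral_comp_eval (f := fun z : ℂ => ‖z‖ ^ 2)
    (μ := fun _ : Fin n => stdComplexGaussian) (by fun_prop), integral_norm_sq_stdComplexGaussian]
  simp

/-- A standard complex Gaussian vector has covariance the identity. -/
lemma integral_norm_inner_sq_stdComplexGaussianVec {M : ℕ} (u : EuclideanSpace ℂ (Fin M)) :
    ∫ x, ‖inner ℂ x u‖ ^ 2 ∂stdComplexGaussianVec M = ‖u‖ ^ 2 := by
  rcases eq_or_ne u 0 with rfl | hu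
  · simp
  -- The one-element orthonormal family u/‖u‖ reduces the claim to the second moment of a single
  -- `CN(0,1)` coefficient.
  set e : Fin 1 → EuclideanSpace ℂ (Fin M) := fun _ => ((‖u‖ : ℂ)⁻¹) • u with he
  have hu' : ‖u‖ ≠ 0 := norm_ne_zero_iff.2 hu
  have hon : Orthonormal ℂ e := by
    refine ⟨fun k => ?_, fun j k hjk => (hjk (Subsingleton.elim _ _)).elim⟩
    rw [he, norm_smul, norm_inv, Complex.norm_real, norm_norm, inv_mul_cancel₀ hu']
  have h := integral_norm_sq_stdComplexGaussianVec 1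
  rw [← map_inner_orthonormal hon, integral_map
    (measurable_toLp_inner e).aemeasurable (by fun_prop)] at h
  have hpt : ∀ x : EuclideanSpace ℂ (Fin M),
      ‖(WithLp.toLp 2 fun k => inner ℂ (e k) x : EuclideanSpace ℂ (Fin 1))‖ ^ 2
        = (‖u‖ ^ 2)⁻¹ * ‖inner ℂ x u‖ ^ 2 := by
    intro x
    rw [EuclideanSpace.norm_sq_eq]
    simp only [Finset.univ_unique, Finset.sum_singleton, he, inner_smul_left, norm_mul,
      ← norm_inner_symm x u]
    rw [RCLike.norm_conj, norm_inv, Complex.norm_real, norm_norm]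
    ring
  simp only [hpt] at h
  rw [integral_const_mul] at h
  field_simp at h
  simpa using h

/-! ### Distance to a subspace and almost sure linear independence -/

/-- The inverse squared distance of a standard complex Gaussian vector to a fixed subspace of
codimension `n` has expectation `1 / (n - 1)`. -/
lemma lintegral_inv_norm_sq_starProjection {M n : ℕ} (hn : 2 ≤ n)
    (V : Submodule ℂ (EuclideanSpace ℂ (Fin M))) (hV : Module.finrank ℂ V + n = M) :
    ∫⁻ x, (ENNReal.ofReal (‖Vᗮ.starProjection x‖ ^ 2))⁻¹ ∂stdComplexGaussianVec M
      = ENNReal.ofReal (1 / ((n : ℝ) - 1)) := by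
  have hfin : Module.finrank ℂ Vᗮ = n := by
    have := V.finrank_add_finrank_orthogonal
    rw [finrank_euclideanSpace_fin] at this
    omega
  let b : OrthonormalBasis (Fin n) ℂ Vᗮ :=
    (stdOrthonormalBasis ℂ Vᗮ).reindex (finCongr hfin)
  set e : Fin n → EuclideanSpace ℂ (Fin M) := fun k => b k with he
  have hon : Orthonormal ℂ e := b.orthonormal.comp_linearIsometry Vᗮ.subtypeₗᵢ
  have hpt : ∀ x, ‖Vᗮ.starProjection x‖ ^ 2
      = ‖(WithLp.toLp 2 fun k => inner ℂ (e k) x : EuclideanSpace ℂ (Fin n))‖ ^ 2 := by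
    intro x
    rw [EuclideanSpace.norm_sq_eq (n := Fin n), Submodule.starProjection_apply, ← Submodule.coe_norm,
      ← b.sum_sq_norm_inner_right]
    refine Finset.sum_congr rfl fun k _ => ?_
    rw [Submodule.coe_inner, ← Submodule.starProjection_apply,
      ← Submodule.inner_starProjection_left_eq_right,
      Submodule.starProjection_eq_self_iff.2 (b k).2]
  simp only [hpt]
  rw [← lintegral_inv_norm_sq_stdComplexGaussianVec hn, ← map_inner_orthonormal hon,
    lintegral_map (by fun_prop) (measurable_toLp_inner e)]

/-- On V the distance to V is 0 and its inverse square is ∞, which a finite expectation excludes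
almost surely. Codimension 2 is what makes that expectation finite. -/
lemma ae_notMem_of_finrank {M : ℕ} (V : Submodule ℂ (EuclideanSpace ℂ (Fin M)))
    (hV : Module.finrank ℂ V + 2 ≤ M) : ∀ᵐ x ∂stdComplexGaussianVec M, x ∉ V := by
  obtain ⟨n, hn⟩ := Nat.exists_eq_add_of_le hV
  have h := lintegral_inv_norm_sq_starProjection (n := 2 + n) (by omega) V (by omega)
  have hlt := ae_lt_top (by fun_prop) (h.trans_ne ENNReal.ofReal_ne_top)
  filter_upwards [hlt] with x hx hxV
  rw [Submodule.starProjection_orthogonal_apply_eq_zero hxV] at hx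
  simp at hx

lemma continuous_gram {M K : ℕ} :
    Continuous fun v : Fin K → EuclideanSpace ℂ (Fin M) => Matrix.gram ℂ v :=
  continuous_matrix fun i j => by simp only [Matrix.gram_apply]; fun_prop

/-- Independence means a nonzero Gram determinant, an open condition. -/
lemma measurableSet_linearIndependent {M K : ℕ} :
    MeasurableSet {v : Fin K → EuclideanSpace ℂ (Fin M) | LinearIndependent ℂ v} := by
  simp only [← Matrix.det_gram_ne_zero_iff_linearIndependent]
  exact (isOpen_ne_fun continuous_gram.matrix_det continuous_const).measurableSet

/-- Fewer than `M` independent Gaussian vectors in `ℂ^M` are a.s. linearly independent. -/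
lemma ae_linearIndependent {M : ℕ} : ∀ {n : ℕ}, n < M →
    ∀ᵐ v ∂(Measure.pi fun _ : Fin n => stdComplexGaussianVec M), LinearIndependent ℂ v
  | 0, _ => ae_of_all _ fun v => linearIndependent_empty_type
  | n + 1, hn => by
    have hmp := (measurePreserving_piFinSuccAbove
      (fun _ : Fin (n + 1) => stdComplexGaussianVec M) 0).symm
    rw [← hmp.map_eq, ae_map_iff hmp.measurable.aemeasurable measurableSet_linearIndependent]
    have hms : MeasurableSet {p : EuclideanSpace ℂ (Fin M) × (Fin n → EuclideanSpace ℂ (Fin M)) |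
        LinearIndependent ℂ ((MeasurableEquiv.piFinSuccAbove
          (fun _ : Fin (n + 1) => EuclideanSpace ℂ (Fin M)) 0).symm p)} :=
      hmp.measurable measurableSet_linearIndependent
    -- Fix the n later vectors before the new one: their span has codimension M - n ≥ 2, so the new
    -- vector almost surely avoids it.
    rw [Measure.ae_prod_iff_ae_ae hms, Measure.ae_ae_comm hms]
    filter_upwards [ae_linearIndependent (n := n) (by omega)] with v hv
    filter_upwards [ae_notMem_of_finrank (Submodule.span ℂ (Set.range v)) (by
      rw [finrank_span_eq_card hv, Fintype.card_fin]; omega)] with x hx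
    have : (MeasurableEquiv.piFinSuccAbove
          (fun _ : Fin (n + 1) => EuclideanSpace ℂ (Fin M)) 0).symm (x, v) = Fin.cons x v := by
      rw [← Fin.insertNth_zero']
      rfl
    rw [this]
    exact linearIndependent_finCons.2 ⟨hv, hx⟩

/-! ### Geometry of zero forcing -/

/-- If `a` is a combination of the `v k`, is orthogonal to a subspace `W` containing all `v j`
with `j ≠ i`, and has inner product `1` with `v i`, then `‖a‖⁻¹` is the distance of `v i` to
`W`. -/
lemma norm_sq_mul_norm_sq_starProjection_eq_one {E ι : Type*} [NormedAddCommGroup E]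
    [InnerProductSpace ℂ E] [FiniteDimensional ℂ E] [Fintype ι] {v : ι → E} {i : ι} {a : E}
    {c : ι → ℂ} {W : Submodule ℂ E} (ha : a = ∑ k, c k • v k) (hW : ∀ j, j ≠ i → v j ∈ W)
    (haW : a ∈ Wᗮ) (hai : inner ℂ a (v i) = 1) :
    ‖a‖ ^ 2 * ‖Wᗮ.starProjection (v i)‖ ^ 2 = 1 := by
  -- Projecting onto Wᗮ fixes a and kills every term of the combination except the i-th.
  have h1 : a = c i • Wᗮ.starProjection (v i) := by
    rw [← Submodule.starProjection_eq_self_iff.2 haW]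
    conv_lhs => rw [ha]
    rw [map_sum, Finset.sum_eq_single i, map_smul]
    · intro j _ hj
      rw [map_smul, Submodule.starProjection_orthogonal_apply_eq_zero (hW j hj), smul_zero]
    · simp
  have h2 : inner ℂ a (Wᗮ.starProjection (v i)) = 1 := by
    rw [← Submodule.inner_starProjection_left_eq_right,
      Submodule.starProjection_eq_self_iff.2 haW, hai]
  set p := Wᗮ.starProjection (v i)
  have h3 : ‖c i‖ * ‖p‖ ^ 2 = 1 := by
    rw [h1, inner_smul_left, inner_self_eq_norm_sq_to_K] at h2
    have := congrArg norm h2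
    simpa using this
  calc ‖a‖ ^ 2 * ‖p‖ ^ 2 = (‖c i‖ * ‖p‖ ^ 2) ^ 2 := by rw [h1, norm_smul]; ring
    _ = 1 := by rw [h3, one_pow]

section ZeroForcing

variable {M K : ℕ} {Ω : Type*} (P : Params K) (h : Fin K → Fin M → Ω → ℂ) (ω : Ω)

lemma conjTranspose_mul_chanMatrix :
    (chanMatrix P h ω).conjTranspose * chanMatrix P h ω
      = Matrix.gram ℂ fun i => chan P h i ω := by
  ext i j
  simp [Matrix.mul_apply, Matrix.gram_apply, chanMatrix, PiLp.inner_apply, mul_comm]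

lemma zfVector_eq_sum (i : Fin K) :
    zfVector P h i ω
      = ∑ k, ((Matrix.gram ℂ fun i => chan P h i ω)⁻¹ k i) • chan P h k ω := by
  ext j
  simp only [zfVector, conjTranspose_mul_chanMatrix, Matrix.mul_apply]
  simp [chanMatrix, mul_comm]

/-- These inner products are the entries of (GᴴG)⁻¹(GᴴG) = 1; the conjugation on the left slot is
absorbed because the inverse Gram matrix is Hermitian. -/
lemma inner_zfVector_chan (hli : LinearIndependent ℂ fun i => chan P h i ω) (i j : Fin K) :
    inner ℂ (zfVector P h i ω) (chan P h j ω) = if i = j then 1 else 0 := by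
  set G := Matrix.gram ℂ fun i => chan P h i ω with hG
  have hdet : IsUnit G.det := (Matrix.det_gram_ne_zero_iff_linearIndependent.2 hli).isUnit
  rw [zfVector_eq_sum, sum_inner, ← Matrix.one_apply, ← Matrix.nonsing_inv_mul G hdet,
    Matrix.mul_apply]
  refine Finset.sum_congr rfl fun k _ => ?_
  rw [inner_smul_left, ← Matrix.gram_apply (𝕜 := ℂ) (fun i => chan P h i ω),
    ← ((Matrix.isHermitian_gram ℂ fun i => chan P h i ω).inv).apply i k]
  rfl

end ZeroForcing

/-! ### Expected norm of the zero-forcing vector -/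

/-- The small-scale fading coefficients as coordinate functions of the channel realization. -/
def coordFading (M K : ℕ) (i : Fin K) (j : Fin M) (H : Fin K → EuclideanSpace ℂ (Fin M)) : ℂ :=
  H i j

lemma chan_coordFading {M K : ℕ} (P : Params K) (H : Fin K → EuclideanSpace ℂ (Fin M))
    (i : Fin K) : chan P (coordFading M K) i H = (Real.sqrt (P.β i) : ℂ) • H i := by
  ext j
  simp [chan, coordFading]

/-- Matrix inversion is not continuous, but it is the inverse determinant times the adjugate, hence
measurable. -/
lemma measurable_zfVector {M K : ℕ} (P : Params K) (i : Fin K) :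
    Measurable (zfVector P (coordFading M K) i) := by
  have hG : Continuous fun H : Fin K → EuclideanSpace ℂ (Fin M) =>
      Matrix.gram ℂ fun i => (Real.sqrt (P.β i) : ℂ) • H i :=
    continuous_gram.comp (by fun_prop)
  simp only [funext (zfVector_eq_sum P (coordFading M K) · i), chan_coordFading]
  refine Finset.measurable_sum _ fun k _ => ?_
  have hinv : Measurable fun H : Fin K → EuclideanSpace ℂ (Fin M) =>
      (Matrix.gram ℂ fun i => (Real.sqrt (P.β i) : ℂ) • H i)⁻¹ k i := by
    simp only [Matrix.inv_def, Matrix.smul_apply, Ring.inverse_eq_inv', smul_eq_mul]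
    exact hG.matrix_det.measurable.inv.mul (hG.matrix_adjugate.matrix_elem k i).measurable
  have hvec : Measurable fun H : Fin K → EuclideanSpace ℂ (Fin M) =>
      (Real.sqrt (P.β k) : ℂ) • H k := by fun_prop
  exact hinv.smul hvec

lemma linearIndependent_chan_coordFading {M K : ℕ} {P : Params K} (hβ : ∀ i, 0 < P.β i)
    {H : Fin K → EuclideanSpace ℂ (Fin M)} (hH : LinearIndependent ℂ H) :
    LinearIndependent ℂ fun i => chan P (coordFading M K) i H := by
  simp only [chan_coordFading]
  exact hH.units_smul fun i => Units.mk0 (Real.sqrt (P.β i) : ℂ)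
    (by exact_mod_cast (Real.sqrt_pos.2 (hβ i)).ne')

lemma ofReal_norm_zfVector_sq {M k : ℕ} {P : Params (k + 1)} (hβ : ∀ i, 0 < P.β i)
    {H : Fin (k + 1) → EuclideanSpace ℂ (Fin M)} (hH : LinearIndependent ℂ H) (i : Fin (k + 1)) :
    ENNReal.ofReal (‖zfVector P (coordFading M (k + 1)) i H‖ ^ 2)
      = ENNReal.ofReal (1 / P.β i) * (ENNReal.ofReal (‖(Submodule.span ℂ
          (Set.range fun j => H (i.succAbove j)))ᗮ.starProjection (H i)‖ ^ 2))⁻¹ := by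
  set W := Submodule.span ℂ (Set.range fun j => H (i.succAbove j))
  have hli := linearIndependent_chan_coordFading hβ hH
  have hmem : ∀ j, j ≠ i → H j ∈ W := by
    intro j hj
    obtain ⟨l, rfl⟩ := Fin.exists_succAbove_eq hj
    exact Submodule.subset_span ⟨l, rfl⟩
  have hβ' : ∀ j, (Real.sqrt (P.β j) : ℂ) ≠ 0 := fun j => by
    exact_mod_cast (Real.sqrt_pos.2 (hβ j)).ne'
  have h1 := norm_sq_mul_norm_sq_starProjection_eq_one (i := i) (W := W)
    (zfVector_eq_sum P (coordFading M (k + 1)) H i)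
    (fun j hj => by rw [chan_coordFading]; exact W.smul_mem _ (hmem j hj))
    (by
      rw [Submodule.mem_orthogonal']
      intro u hu
      induction hu using Submodule.span_induction with
      | mem x hx =>
        obtain ⟨l, rfl⟩ := hx
        have := inner_zfVector_chan P (coordFading M (k + 1)) H hli i (i.succAbove l)
        rw [chan_coordFading, inner_smul_right, if_neg (Fin.succAbove_ne i l).symm] at this
        exact (mul_eq_zero.1 this).resolve_left (hβ' _)
      | zero => exact inner_zero_right _
      | add x y _ _ hx hy => rw [inner_add_right, hx, hy, add_zero]
      | smul c x _ hx => rw [inner_smul_right, hx, mul_zero])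
    (by rw [inner_zfVector_chan P _ H hli, if_pos rfl])
  rw [chan_coordFading, map_smul, norm_smul, mul_pow, Complex.norm_real, Real.norm_eq_abs, sq_abs,
    Real.sq_sqrt (hβ i).le] at h1
  set d := ‖Wᗮ.starProjection (H i)‖ ^ 2
  have hd : 0 < d := lt_of_le_of_ne (sq_nonneg _) fun hd => by simp [← hd] at h1
  rw [← ENNReal.ofReal_inv_of_pos hd, ← ENNReal.ofReal_mul (by have := hβ i; positivity)]
  congr 1
  have := hβ i
  field_simp
  linarith

/-- The expected squared norm of the zero-forcing vector. -/
lemma lintegral_norm_zfVector_sq {M K : ℕ} (hKM : K < M) {P : Params K} (hβ : ∀ i, 0 < P.β i)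
    (i : Fin K) :
    ∫⁻ H, ENNReal.ofReal (‖zfVector P (coordFading M K) i H‖ ^ 2)
        ∂(Measure.pi fun _ : Fin K => stdComplexGaussianVec M)
      = ENNReal.ofReal (1 / (P.β i * ((M : ℝ) - K))) := by
  obtain ⟨k, rfl⟩ : ∃ k, K = k + 1 := ⟨K - 1, by have := i.pos; omega⟩
  have hmp := (measurePreserving_piFinSuccAbove
      (fun _ : Fin (k + 1) => stdComplexGaussianVec M) i).symm
  have hmeas : Measurable fun H =>
      ENNReal.ofReal (‖zfVector P (coordFading M (k + 1)) i H‖ ^ 2) :=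
    ((measurable_zfVector P i).norm.pow_const 2).ennreal_ofReal
  have hli := ae_linearIndependent hKM
  rw [← hmp.map_eq] at hli ⊢
  rw [ae_map_iff hmp.measurable.aemeasurable measurableSet_linearIndependent] at hli
  rw [lintegral_map hmeas hmp.measurable]
  -- Integrate over the vector of user i first, the others being fixed; by `hconst` the inner
  -- integral is almost surely the same constant.
  refine (lintegral_prod_symm' _ (hmeas.comp hmp.measurable)).trans ?_
  have hms : MeasurableSet {p : EuclideanSpace ℂ (Fin M) × (Fin k → EuclideanSpace ℂ (Fin M)) |
      LinearIndependent ℂ ((MeasurableEquiv.piFinSuccAbove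
        (fun _ : Fin (k + 1) => EuclideanSpace ℂ (Fin M)) i).symm p)} :=
    hmp.measurable measurableSet_linearIndependent
  rw [Measure.ae_prod_iff_ae_ae hms, Measure.ae_ae_comm hms] at hli
  have hconst : ∀ᵐ v ∂(Measure.pi fun _ : Fin k => stdComplexGaussianVec M),
      ∫⁻ x, ENNReal.ofReal (‖zfVector P (coordFading M (k + 1)) i
        ((MeasurableEquiv.piFinSuccAbove
          (fun _ : Fin (k + 1) => EuclideanSpace ℂ (Fin M)) i).symm (x, v))‖ ^ 2)
        ∂stdComplexGaussianVec M
      = ENNReal.ofReal (1 / (P.β i * ((M : ℝ) - (k + 1 : ℕ)))) := by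
    filter_upwards [hli] with v hv
    have hsymm : ∀ x, (MeasurableEquiv.piFinSuccAbove
        (fun _ : Fin (k + 1) => EuclideanSpace ℂ (Fin M)) i).symm (x, v) = i.insertNth x v :=
      fun x => rfl
    simp only [hsymm] at hv ⊢
    obtain ⟨x₀, hx₀⟩ := hv.exists
    have hvli : LinearIndependent ℂ v := by
      simpa [Function.comp_def] using hx₀.comp i.succAbove Fin.succAbove_right_injective
    -- With k = K - 1 other users the codimension is n = M - k = M - K + 1 ≥ 2, and 1/(n - 1)
    -- becomes 1/(M - K).
    have hfin : Module.finrank ℂ (Submodule.span ℂ (Set.range v)) + (M - k) = M := by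
      rw [finrank_span_eq_card hvli, Fintype.card_fin]
      omega
    have hcongr : ∀ᵐ x ∂stdComplexGaussianVec M,
        ENNReal.ofReal (‖zfVector P (coordFading M (k + 1)) i (i.insertNth x v)‖ ^ 2)
          = ENNReal.ofReal (1 / P.β i) * (ENNReal.ofReal (‖(Submodule.span ℂ
            (Set.range v))ᗮ.starProjection x‖ ^ 2))⁻¹ := by
      filter_upwards [hv] with x hx
      rw [ofReal_norm_zfVector_sq hβ hx]
      simp
    rw [lintegral_congr_ae hcongr, lintegral_const_mul _ (by fun_prop),
      lintegral_inv_norm_sq_starProjection (by omega) _ hfin,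
      ← ENNReal.ofReal_mul (by have := hβ i; positivity), Nat.cast_sub (by omega)]
    congr 1
    push_cast
    rw [← sub_sub, one_div_mul_one_div]
  simp only [Function.comp_apply]
  rw [lintegral_congr_ae hconst]
  simp

/-! ### Law of the channel realization -/

/-- The channel realization, as a random family of vectors, has the law of a family of i.i.d.
standard complex Gaussian vectors. -/
lemma hasLaw_fading {M K : ℕ} {Ω : Type*} [MeasurableSpace Ω] {μ : Measure Ω}
    {h : Fin K → Fin M → Ω → ℂ} (hlaw : ∀ i j, HasLaw (h i j) stdComplexGaussian μ)
    (hindep : iIndepFun (fun q : Fin K × Fin M => h q.1 q.2) μ) :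
    HasLaw (fun ω i => (WithLp.toLp 2 fun j => h i j ω : EuclideanSpace ℂ (Fin M)))
      (Measure.pi fun _ : Fin K => stdComplexGaussianVec M) μ := by
  have h1 : HasLaw (fun ω (q : Fin K × Fin M) => h q.1 q.2 ω)
      (Measure.pi fun _ => stdComplexGaussian) μ :=
    hindep.hasLaw_pi fun q => hlaw q.1 q.2
  have h2 : MeasurePreserving (MeasurableEquiv.curry (Fin K) (Fin M) ℂ)
      (Measure.pi fun _ => stdComplexGaussian)
      (Measure.pi fun _ => Measure.pi fun _ => stdComplexGaussian) := by
    refine ⟨MeasurableEquiv.measurable _, ?_⟩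
    have := Measure.infinitePi_map_curry (fun (_ : Fin K) (_ : Fin M) => stdComplexGaussian)
    simpa only [Measure.infinitePi_eq_pi] using this
  have h3 : MeasurePreserving
      (fun (c : Fin K → Fin M → ℂ) i => (WithLp.toLp 2 (c i) : EuclideanSpace ℂ (Fin M)))
      (Measure.pi fun _ => Measure.pi fun _ => stdComplexGaussian)
      (Measure.pi fun _ => stdComplexGaussianVec M) :=
    measurePreserving_pi _ _ (f := fun _ => WithLp.toLp 2)
      fun _ => ⟨measurable_toLp_complex M, rfl⟩
  exact (h3.comp h2).comp_hasLaw h1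

/-! ### Downlink beamforming gain and received energy -/

/-- The unit vector in the direction of `x`, or `0` if `x = 0`. -/
noncomputable def direction {E : Type*} [NormedAddCommGroup E] [NormedSpace ℂ E] (x : E) : E :=
  ((‖x‖⁻¹ : ℝ) : ℂ) • x

section Direction

variable {E : Type*} [NormedAddCommGroup E] [InnerProductSpace ℂ E]

lemma direction_neg (x : E) : direction (-x) = -direction x := by
  simp [direction]

lemma norm_direction {x : E} (hx : x ≠ 0) : ‖direction x‖ = 1 := by
  have : ‖x‖ ≠ 0 := norm_ne_zero_iff.2 hx
  rw [direction, norm_smul, Complex.norm_real, norm_inv, norm_norm, inv_mul_cancel₀ this]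

lemma norm_direction_le (x : E) : ‖direction x‖ ≤ 1 := by
  rcases eq_or_ne x 0 with rfl | hx
  · simp [direction]
  · exact (norm_direction hx).le

lemma norm_inner_direction_self (x : E) : ‖inner ℂ x (direction x)‖ = ‖x‖ := by
  rcases eq_or_ne x 0 with rfl | hx
  · simp
  · have : ‖x‖ ≠ 0 := norm_ne_zero_iff.2 hx
    rw [direction, inner_smul_right, inner_self_eq_norm_sq_to_K, norm_mul, Complex.norm_real,
      norm_inv, norm_norm, norm_pow]
    simp
    field_simp

lemma norm_inner_direction_le (x y : E) : ‖inner ℂ x (direction y)‖ ≤ ‖x‖ :=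
  (norm_inner_le_norm _ _).trans
    (mul_le_of_le_one_right (norm_nonneg _) (norm_direction_le y))

end Direction

lemma measurable_direction {n : ℕ} :
    Measurable (direction : EuclideanSpace ℂ (Fin n) → EuclideanSpace ℂ (Fin n)) :=
  (Complex.measurable_ofReal.comp measurable_norm.inv).smul measurable_id

lemma measurable_inner_direction {M K : ℕ} (i j : Fin K) :
    Measurable fun H : Fin K → EuclideanSpace ℂ (Fin M) => inner ℂ (H i) (direction (H j)) :=
  (measurable_pi_apply i).inner (measurable_direction.comp (measurable_pi_apply j))

lemma integrable_inner_direction_inner_direction {M K : ℕ} (i j k : Fin K) :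
    Integrable (fun H : Fin K → EuclideanSpace ℂ (Fin M) =>
      (inner ℝ (inner ℂ (H i) (direction (H j)) : ℂ) (inner ℂ (H i) (direction (H k)) : ℂ) : ℝ))
      (Measure.pi fun _ => stdComplexGaussianVec M) := by
  have hint : Integrable (fun H : Fin K → EuclideanSpace ℂ (Fin M) => ‖H i‖ ^ 2)
      (Measure.pi fun _ => stdComplexGaussianVec M) :=
    integrable_comp_eval (μ := fun _ : Fin K => stdComplexGaussianVec M)
      (f := fun x : EuclideanSpace ℂ (Fin M) => ‖x‖ ^ 2)
      (integrable_norm_sq_stdComplexGaussianVec M)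
  refine hint.mono' ((measurable_inner_direction i j).inner
    (measurable_inner_direction i k)).aestronglyMeasurable (ae_of_all _ fun H => ?_)
  refine (norm_inner_le_norm _ _).trans ?_
  rw [sq]
  exact mul_le_mul (norm_inner_direction_le _ _) (norm_inner_direction_le _ _) (norm_nonneg _)
    (norm_nonneg _)

lemma measurePreserving_neg_eval (M K : ℕ) (l : Fin K) :
    MeasurePreserving (fun (H : Fin K → EuclideanSpace ℂ (Fin M)) m => if m = l then -H m else H m)
      (Measure.pi fun _ => stdComplexGaussianVec M)
      (Measure.pi fun _ => stdComplexGaussianVec M) := by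
  refine measurePreserving_pi _ _ (f := fun m x => if m = l then -x else x) fun m => ?_
  by_cases hm : m = l
  · simpa [hm] using measurePreserving_neg_stdComplexGaussianVec M
  · simp only [if_neg hm]
    exact MeasurePreserving.id _

/-- Negating H k, when k ≠ i, preserves the law and flips the sign of the integrand, so the cross
term vanishes. -/
lemma integral_inner_direction_of_ne {M K : ℕ} (i : Fin K) {j k : Fin K} (hjk : j ≠ k) :
    ∫ H : Fin K → EuclideanSpace ℂ (Fin M),
      (inner ℝ (inner ℂ (H i) (direction (H j)) : ℂ) (inner ℂ (H i) (direction (H k)) : ℂ) : ℝ)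
      ∂(Measure.pi fun _ => stdComplexGaussianVec M) = 0 := by
  -- If k = i then j ≠ i, and symmetry of the real inner product exchanges j and k.
  wlog hk : k ≠ i generalizing j k with hw
  · push Not at hk
    subst hk
    have := hw hjk.symm hjk
    simpa only [real_inner_comm] using this
  have hmp := measurePreserving_neg_eval M K k
  have hmeas := (measurable_inner_direction (M := M) i j).inner (𝕜 := ℝ)
    (measurable_inner_direction i k)
  have h := integral_map (μ := Measure.pi fun _ => stdComplexGaussianVec M)
    hmp.measurable.aemeasurable hmeas.aestronglyMeasurable
  rw [hmp.map_eq] at h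
  simp only [if_neg hk.symm, if_neg hjk, if_true, direction_neg, inner_neg_right,
    integral_neg] at h
  linarith

lemma integral_norm_inner_direction_self {M K : ℕ} (i : Fin K) :
    ∫ H : Fin K → EuclideanSpace ℂ (Fin M), ‖inner ℂ (H i) (direction (H i))‖ ^ 2
      ∂(Measure.pi fun _ => stdComplexGaussianVec M) = M := by
  simp only [norm_inner_direction_self]
  rw [integral_comp_eval (μ := fun _ : Fin K => stdComplexGaussianVec M)
    (f := fun x : EuclideanSpace ℂ (Fin M) => ‖x‖ ^ 2) (by fun_prop),
    integral_norm_sq_stdComplexGaussianVec]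

lemma ae_ne_zero_stdComplexGaussianVec {M : ℕ} (hM : 2 ≤ M) :
    ∀ᵐ x ∂stdComplexGaussianVec M, x ≠ 0 := by
  have hlt := ae_lt_top (by fun_prop)
    ((lintegral_inv_norm_sq_stdComplexGaussianVec hM).trans_ne ENNReal.ofReal_ne_top)
  filter_upwards [hlt] with x hx hx0
  simp [hx0] at hx

/-- Given H j, its direction is almost surely a fixed unit vector independent of H i, and the
covariance of H i is the identity. -/
lemma integral_norm_inner_direction_of_ne {M K : ℕ} (hM : 2 ≤ M) {i j : Fin K} (hij : i ≠ j) :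
    ∫ H : Fin K → EuclideanSpace ℂ (Fin M), ‖inner ℂ (H i) (direction (H j))‖ ^ 2
      ∂(Measure.pi fun _ => stdComplexGaussianVec M) = 1 := by
  have hpair := Measure.infinitePi_map_eval_prod
    (P := fun _ : Fin K => stdComplexGaussianVec M) hij
  rw [Measure.infinitePi_eq_pi] at hpair
  have hmeas : Measurable fun p : EuclideanSpace ℂ (Fin M) × EuclideanSpace ℂ (Fin M) =>
      ‖inner ℂ p.1 (direction p.2)‖ ^ 2 :=
    (measurable_fst.inner (measurable_direction.comp measurable_snd)).norm.pow_const 2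
  have hm : Measurable fun H : Fin K → EuclideanSpace ℂ (Fin M) => (H i, H j) := by fun_prop
  have h := integral_map (μ := Measure.pi fun _ => stdComplexGaussianVec M)
    hm.aemeasurable hmeas.aestronglyMeasurable
  rw [← h, hpair, integral_prod_symm]
  · simp only [integral_norm_inner_sq_stdComplexGaussianVec]
    have : ∀ᵐ x ∂stdComplexGaussianVec M, ‖direction x‖ ^ 2 = 1 := by
      filter_upwards [ae_ne_zero_stdComplexGaussianVec hM] with x hx
      rw [norm_direction hx, one_pow]
    rw [integral_congr_ae this]
    simp
  · refine ((integrable_norm_sq_stdComplexGaussianVec M).comp_fst _).mono'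
      hmeas.aestronglyMeasurable (ae_of_all _ fun p => ?_)
    rw [norm_pow, norm_norm]
    exact pow_le_pow_left₀ (norm_nonneg _) (norm_inner_direction_le _ _) 2

lemma norm_sq_sum_smul {ι : Type*} (s : Finset ι) (c : ι → ℝ) (a : ι → ℂ) :
    ‖∑ j ∈ s, c j • a j‖ ^ 2 = ∑ j ∈ s, ∑ k ∈ s, c j * c k * inner ℝ (a j) (a k) := by
  rw [← real_inner_self_eq_norm_sq, sum_inner]
  refine Finset.sum_congr rfl fun j _ => ?_
  rw [inner_sum]
  refine Finset.sum_congr rfl fun k _ => ?_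
  rw [real_inner_smul_left, real_inner_smul_right]
  ring

section Beamforming

variable {M K : ℕ} (c : Fin K → ℝ) (i : Fin K)

lemma measurable_beamforming :
    Measurable fun H : Fin K → EuclideanSpace ℂ (Fin M) =>
      ∑ j, c j • (inner ℂ (H i) (direction (H j)) : ℂ) :=
  Finset.measurable_sum _ fun j _ => (measurable_inner_direction i j).const_smul (c j)

lemma integrable_beamforming :
    Integrable (fun H : Fin K → EuclideanSpace ℂ (Fin M) =>
      ‖∑ j, c j • (inner ℂ (H i) (direction (H j)) : ℂ)‖ ^ 2)
      (Measure.pi fun _ => stdComplexGaussianVec M) := by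
  simp only [norm_sq_sum_smul]
  exact integrable_finsetSum _ fun j _ => integrable_finsetSum _ fun k _ =>
    (integrable_inner_direction_inner_direction i j k).const_mul _

/-- Average gain at user `i` of a superposition of maximum ratio beams with amplitudes `c j`. -/
lemma integral_beamforming (hM : 2 ≤ M) :
    ∫ H : Fin K → EuclideanSpace ℂ (Fin M),
      ‖∑ j, c j • (inner ℂ (H i) (direction (H j)) : ℂ)‖ ^ 2
      ∂(Measure.pi fun _ => stdComplexGaussianVec M)
      = ∑ j, c j ^ 2 * (if j = i then (M : ℝ) else 1) := by
  simp only [norm_sq_sum_smul]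
  rw [integral_finsetSum _ fun j _ => integrable_finsetSum _ fun k _ =>
    (integrable_inner_direction_inner_direction i j k).const_mul _]
  refine Finset.sum_congr rfl fun j _ => ?_
  rw [integral_finsetSum _ fun k _ =>
    (integrable_inner_direction_inner_direction i j k).const_mul _]
  rw [Finset.sum_eq_single j]
  · rw [integral_const_mul, ← sq]
    simp only [real_inner_self_eq_norm_sq]
    congr 1
    split_ifs with hji
    · rw [hji, integral_norm_inner_direction_self]
    · exact integral_norm_inner_direction_of_ne hM (Ne.symm hji)
  · intro k _ hk
    rw [integral_const_mul, integral_inner_direction_of_ne i hk.symm, mul_zero]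
  · simp

end Beamforming

/-- Directions do not change under positive scaling, so every β j with j ≠ i cancels from the
precoder; only the receiver's own gain remains. -/
lemma norm_rxSignal_sq {M K : ℕ} {Ω : Type*} {P : Params K} (hβ : ∀ i, 0 < P.β i)
    (h : Fin K → Fin M → Ω → ℂ) (s : Ω → ℂ) (i : Fin K) (ω : Ω) :
    ‖rxSignal P h s i ω‖ ^ 2
      = P.β i * ‖∑ j, Real.sqrt (P.ζ j) • (inner ℂ (WithLp.toLp 2 fun k => h i k ω :
          EuclideanSpace ℂ (Fin M)) (direction (WithLp.toLp 2 fun k => h j k ω)) : ℂ)‖ ^ 2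
        * ‖s ω‖ ^ 2 := by
  have hchan : ∀ j, chan P h j ω = (Real.sqrt (P.β j) : ℂ) •
      (WithLp.toLp 2 fun k => h j k ω : EuclideanSpace ℂ (Fin M)) := fun j => rfl
  have hpre : precoder P h ω = ∑ j, (Real.sqrt (P.ζ j) : ℂ) •
      direction (WithLp.toLp 2 fun k => h j k ω : EuclideanSpace ℂ (Fin M)) := by
    refine Finset.sum_congr rfl fun j _ => ?_
    have hb := Real.sqrt_pos.2 (hβ j)
    rw [hchan, direction, norm_smul, smul_smul, smul_smul, Complex.norm_real,
      Real.norm_of_nonneg hb.le]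
    congr 1
    rw [← Complex.ofReal_mul, ← Complex.ofReal_mul]
    congr 1
    rw [div_mul_eq_mul_div, mul_comm (Real.sqrt (P.β j)), mul_div_mul_right _ _ hb.ne',
      div_eq_mul_inv]
  rw [rxSignal, hpre, hchan, inner_smul_left, inner_sum, norm_mul, norm_mul, RCLike.norm_conj,
    Complex.norm_real, mul_pow, mul_pow, Real.norm_eq_abs, sq_abs, Real.sq_sqrt (hβ i).le]
  simp only [inner_smul_right, Complex.real_smul]

/-- The average received energy. -/
lemma rxEnergy_eq {M K : ℕ} (hKM : K < M) {Ω : Type*} [MeasurableSpace Ω] {μ : Measure Ω}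
    {P : Params K} (hpdl : 0 < P.pdl) (hζ : ∀ i, 0 < P.ζ i) (hζsum : ∑ i, P.ζ i = 1)
    (hβ : ∀ i, 0 < P.β i) {h : Fin K → Fin M → Ω → ℂ}
    (hlaw : ∀ i j, HasLaw (h i j) stdComplexGaussian μ)
    (hindep : iIndepFun (fun q : Fin K × Fin M => h q.1 q.2) μ)
    {s : Ω → ℂ} (hspow : ∫ ω, ‖s ω‖ ^ 2 ∂μ = P.pdl)
    (hsindep : IndepFun s (fun ω (q : Fin K × Fin M) => h q.1 q.2 ω) μ) (i : Fin K) :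
    Integrable (fun ω => ‖rxSignal P h s i ω‖ ^ 2) μ ∧
      rxEnergy μ P h s i
        = P.αWET * P.pdl * P.β i * (P.ζ i * (M : ℝ) + (1 - P.ζ i)) := by
  have hL := hasLaw_fading hlaw hindep
  set X : Ω → Fin K → EuclideanSpace ℂ (Fin M) := fun ω i => WithLp.toLp 2 fun j => h i j ω
  set F : (Fin K → EuclideanSpace ℂ (Fin M)) → ℝ := fun H =>
    ‖∑ j, Real.sqrt (P.ζ j) • (inner ℂ (H i) (direction (H j)) : ℂ)‖ ^ 2 with hF
  have hFm : Measurable F := (measurable_beamforming _ i).norm.pow_const 2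
  have hFi : Integrable F (Measure.pi fun _ => stdComplexGaussianVec M) :=
    integrable_beamforming _ i
  have hM : 2 ≤ M := by have := i.pos; omega
  have hFv : ∫ H, F H ∂(Measure.pi fun _ => stdComplexGaussianVec M)
      = P.ζ i * (M : ℝ) + (1 - P.ζ i) := by
    have herase : 1 - P.ζ i = ∑ j ∈ Finset.univ.erase i, P.ζ j := by
      rw [← hζsum, ← Finset.add_sum_erase _ P.ζ (Finset.mem_univ i), add_sub_cancel_left]
    rw [hF, integral_beamforming _ i hM, ← Finset.add_sum_erase _ _ (Finset.mem_univ i),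
      if_pos rfl, Real.sq_sqrt (hζ i).le, herase]
    congr 1
    refine Finset.sum_congr rfl fun j hj => ?_
    rw [if_neg (Finset.ne_of_mem_erase hj), Real.sq_sqrt (hζ j).le, mul_one]
  -- A non-integrable function has Bochner integral 0, so the positive value of `hspow` forces
  -- integrability.
  have hsi : Integrable (fun ω => ‖s ω‖ ^ 2) μ := by
    by_contra hns
    rw [integral_undef hns] at hspow
    exact hpdl.ne hspow
  have hXi : Integrable (fun ω => F (X ω)) μ := by
    rw [← hL.map_eq] at hFi
    exact hFi.comp_aemeasurable hL.aemeasurable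
  have hXv : ∫ ω, F (X ω) ∂μ = P.ζ i * (M : ℝ) + (1 - P.ζ i) := by
    rw [← hFv]
    exact hL.integral_comp hFm.aestronglyMeasurable
  have hind : IndepFun (fun ω => F (X ω)) (fun ω => ‖s ω‖ ^ 2) μ := by
    have hφ : Measurable fun (c : Fin K × Fin M → ℂ) (i : Fin K) =>
        (WithLp.toLp 2 fun j => c (i, j) : EuclideanSpace ℂ (Fin M)) :=
      measurable_pi_lambda _ fun i => (measurable_toLp_complex M).comp (by fun_prop)
    exact hsindep.symm.comp (hFm.comp hφ) (measurable_norm.pow_const 2)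
  have hpt : ∀ ω, ‖rxSignal P h s i ω‖ ^ 2 = P.β i * (F (X ω) * ‖s ω‖ ^ 2) := fun ω => by
    rw [norm_rxSignal_sq hβ, mul_assoc]
  constructor
  · simp only [hpt]
    exact (hind.integrable_mul hXi hsi).const_mul _
  · rw [rxEnergy]
    simp only [hpt]
    rw [integral_const_mul, hind.integral_fun_mul_eq_mul_integral hXi.1 hsi.1, hXv, hspow]
    ring

/-! ### Jensen's inequality -/

/-- A tangent line bound for the convex function `x ↦ log₂ (1 + 1 / x)`. -/
lemma logb_one_add_inv_tangent {x m : ℝ} (hx : 0 < x) (hm : 0 < m) :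
    Real.logb 2 (1 + m⁻¹) - (x - m) * (1 / (m * (m + 1) * Real.log 2)) ≤ Real.logb 2 (1 + x⁻¹) := by
  have hl : 0 < Real.log 2 := Real.log_pos one_lt_two
  -- From log r ≤ r - 1, replacing x + 1 by m + 1 in the denominator costs only (x - m)² ≥ 0 and
  -- leaves the slope of the tangent at m.
  have h1 : Real.log (1 + m⁻¹) - Real.log (1 + x⁻¹) ≤ (1 + m⁻¹) / (1 + x⁻¹) - 1 := by
    rw [← Real.log_div (by positivity) (by positivity)]
    exact Real.log_le_sub_one_of_pos (by positivity)
  have h2 : (1 + m⁻¹) / (1 + x⁻¹) - 1 = (x - m) / (m * (x + 1)) := by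
    field_simp
    ring
  have h3 : (x - m) / (m * (x + 1)) ≤ (x - m) / (m * (m + 1)) := by
    rw [div_le_div_iff₀ (by positivity) (by positivity)]
    nlinarith [mul_nonneg hm.le (sq_nonneg (x - m))]
  have h4 : (x - m) * (1 / (m * (m + 1) * Real.log 2))
      = (x - m) / (m * (m + 1)) / Real.log 2 := by
    field_simp
  rw [h4, Real.logb, Real.logb, ← sub_div]
  exact div_le_div_of_nonneg_right (by linarith) hl.le

/-- Jensen's inequality for `x ↦ log₂ (1 + 1 / x)`. -/
lemma logb_one_add_inv_integral_le {Ω : Type*} [MeasurableSpace Ω] {μ : Measure Ω}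
    [IsProbabilityMeasure μ] {Y : Ω → ℝ} (hY : Integrable Y μ) (hpos : ∀ᵐ ω ∂μ, 0 < Y ω)
    (hm : 0 < ∫ ω, Y ω ∂μ) (hlog : Integrable (fun ω => Real.logb 2 (1 + (Y ω)⁻¹)) μ) :
    Real.logb 2 (1 + (∫ ω, Y ω ∂μ)⁻¹) ≤ ∫ ω, Real.logb 2 (1 + (Y ω)⁻¹) ∂μ := by
  set m := ∫ ω, Y ω ∂μ with hmdef
  have hint : Integrable (fun ω => (Y ω - m) * (1 / (m * (m + 1) * Real.log 2))) μ :=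
    (hY.sub (integrable_const m)).mul_const _
  have h := integral_mono_ae ((integrable_const (Real.logb 2 (1 + m⁻¹))).sub hint) hlog (by
    filter_upwards [hpos] with ω hω
    exact logb_one_add_inv_tangent hω hm)
  simp only [Pi.sub_apply] at h
  rw [integral_sub (integrable_const _) hint, integral_mul_const,
    integral_sub hY (integrable_const m)] at h
  simpa [← hmdef] using h

/-! ### Uplink SINR and rates -/

section ZeroForcing

lemma chan_eq_coordFading {M K : ℕ} {Ω : Type*} (P : Params K) (h : Fin K → Fin M → Ω → ℂ)
    (i : Fin K) (ω : Ω) :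
    chan P h i ω = chan P (coordFading M K) i fun i => WithLp.toLp 2 fun j => h i j ω :=
  rfl

lemma zfVector_eq_coordFading {M K : ℕ} {Ω : Type*} (P : Params K) (h : Fin K → Fin M → Ω → ℂ)
    (i : Fin K) (ω : Ω) :
    zfVector P h i ω = zfVector P (coordFading M K) i fun i => WithLp.toLp 2 fun j => h i j ω := by
  rw [zfVector_eq_sum, zfVector_eq_sum]
  simp only [chan_eq_coordFading P h]

variable {M K : ℕ} {Ω : Type*} (P : Params K) (h : Fin K → Fin M → Ω → ℂ) (p : Fin K → ℝ) (ω : Ω)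

lemma sinr_eq (hli : LinearIndependent ℂ fun i => chan P h i ω) (i : Fin K) :
    sinr P h p i ω = (P.σ2 / p i * ‖zfVector P h i ω‖ ^ 2)⁻¹ := by
  have h0 : ∑ j ∈ Finset.univ.erase i,
      p j * ‖inner ℂ (zfVector P h i ω) (chan P h j ω)‖ ^ 2 = 0 := by
    refine Finset.sum_eq_zero fun j hj => ?_
    rw [inner_zfVector_chan P h ω hli, if_neg (Finset.ne_of_mem_erase hj).symm]
    simp
  rw [sinr, h0, inner_zfVector_chan P h ω hli, if_pos rfl, norm_one, one_pow, mul_one, zero_add,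
    div_mul_eq_mul_div, inv_div]

/-- Cauchy–Schwarz applied to aᵢᴴgᵢ = 1. It makes aᵢ nonzero and bounds the SINR by a multiple of
‖gᵢ‖². -/
lemma one_le_norm_zfVector_mul (hli : LinearIndependent ℂ fun i => chan P h i ω) (i : Fin K) :
    1 ≤ ‖zfVector P h i ω‖ * ‖chan P h i ω‖ := by
  have := norm_inner_le_norm (𝕜 := ℂ) (zfVector P h i ω) (chan P h i ω)
  rwa [inner_zfVector_chan P h ω hli, if_pos rfl, norm_one] at this

end ZeroForcing

section Uplink

variable {M K : ℕ} {Ω : Type*} [MeasurableSpace Ω] {μ : Measure Ω} {P : Params K}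
  {h : Fin K → Fin M → Ω → ℂ}

lemma ae_linearIndependent_chan (hKM : K < M) (hβ : ∀ i, 0 < P.β i)
    (hlaw : ∀ i j, HasLaw (h i j) stdComplexGaussian μ)
    (hindep : iIndepFun (fun q : Fin K × Fin M => h q.1 q.2) μ) :
    ∀ᵐ ω ∂μ, LinearIndependent ℂ fun i => chan P h i ω := by
  have hL := hasLaw_fading hlaw hindep
  have hae := ae_linearIndependent hKM
  rw [← hL.map_eq, ae_map_iff hL.aemeasurable measurableSet_linearIndependent] at hae
  filter_upwards [hae] with ω hω
  simpa only [← chan_eq_coordFading] using linearIndependent_chan_coordFading hβ hω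

lemma aemeasurable_zfVector (hlaw : ∀ i j, HasLaw (h i j) stdComplexGaussian μ)
    (hindep : iIndepFun (fun q : Fin K × Fin M => h q.1 q.2) μ) (i : Fin K) :
    AEMeasurable (zfVector P h i) μ := by
  rw [funext (zfVector_eq_coordFading P h i)]
  exact (measurable_zfVector P i).comp_aemeasurable (hasLaw_fading hlaw hindep).aemeasurable

lemma lintegral_zfVector (hKM : K < M) (hβ : ∀ i, 0 < P.β i)
    (hlaw : ∀ i j, HasLaw (h i j) stdComplexGaussian μ)
    (hindep : iIndepFun (fun q : Fin K × Fin M => h q.1 q.2) μ) (i : Fin K) :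
    ∫⁻ ω, ENNReal.ofReal (‖zfVector P h i ω‖ ^ 2) ∂μ
      = ENNReal.ofReal (1 / (P.β i * ((M : ℝ) - K))) := by
  rw [← lintegral_norm_zfVector_sq hKM hβ i]
  simp only [zfVector_eq_coordFading P h]
  exact (hasLaw_fading hlaw hindep).lintegral_comp
    (((measurable_zfVector P i).norm.pow_const 2).ennreal_ofReal.aemeasurable)

lemma integrable_norm_chan_sq (hlaw : ∀ i j, HasLaw (h i j) stdComplexGaussian μ)
    (i : Fin K) : Integrable (fun ω => ‖chan P h i ω‖ ^ 2) μ := by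
  have hpt : ∀ ω, ‖chan P h i ω‖ ^ 2 = ∑ j, Real.sqrt (P.β i) ^ 2 * ‖h i j ω‖ ^ 2 := fun ω => by
    simp [EuclideanSpace.norm_sq_eq, chan, mul_pow]
  simp only [hpt]
  refine integrable_finsetSum _ fun j _ => Integrable.const_mul ?_ _
  have := integrable_norm_sq_stdComplexGaussian
  rw [← (hlaw i j).map_eq] at this
  exact this.comp_aemeasurable (hlaw i j).aemeasurable

/-- The expected inverse SINR. -/
lemma lintegral_inv_sinr (hKM : K < M) (hσ : 0 < P.σ2) (hβ : ∀ i, 0 < P.β i)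
    (hlaw : ∀ i j, HasLaw (h i j) stdComplexGaussian μ)
    (hindep : iIndepFun (fun q : Fin K × Fin M => h q.1 q.2) μ) {p : Fin K → ℝ} {i : Fin K}
    (hp : 0 < p i) :
    ∫⁻ ω, (ENNReal.ofReal (sinr P h p i ω))⁻¹ ∂μ
      = ENNReal.ofReal (P.σ2 / (p i * P.β i * ((M : ℝ) - K))) := by
  have hae : ∀ᵐ ω ∂μ, (ENNReal.ofReal (sinr P h p i ω))⁻¹
      = ENNReal.ofReal (P.σ2 / p i) * ENNReal.ofReal (‖zfVector P h i ω‖ ^ 2) := by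
    filter_upwards [ae_linearIndependent_chan hKM hβ hlaw hindep] with ω hω
    have h1 := one_le_norm_zfVector_mul P h ω hω i
    have hz : 0 < ‖zfVector P h i ω‖ := (norm_nonneg _).lt_of_ne fun hz => by
      rw [← hz, zero_mul] at h1
      linarith
    rw [sinr_eq P h p ω hω, ENNReal.ofReal_inv_of_pos (by positivity), inv_inv,
      ENNReal.ofReal_mul (by positivity)]
  rw [lintegral_congr_ae hae, lintegral_const_mul' _ _ ENNReal.ofReal_ne_top,
    lintegral_zfVector hKM hβ hlaw hindep, ← ENNReal.ofReal_mul (by positivity)]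
  congr 1
  rw [div_mul_div_comm, mul_one, mul_assoc]

/-- The achievable rate in terms of the uplink symbol energy. -/
lemma achievableRate_eq_of_pos (hKM : K < M) (hσ : 0 < P.σ2) (hβ : ∀ i, 0 < P.β i)
    (hlaw : ∀ i j, HasLaw (h i j) stdComplexGaussian μ)
    (hindep : iIndepFun (fun q : Fin K × Fin M => h q.1 q.2) μ) {s : Ω → ℂ} {i : Fin K}
    (hp : 0 < ulEnergy μ P h s i) :
    achievableRate μ P h s i = P.αWIT * P.B * Real.logb 2
      (1 + ulEnergy μ P h s i * P.β i * ((M : ℝ) - K) / P.σ2) := by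
  have hMK : (0 : ℝ) < (M : ℝ) - K := sub_pos.2 (by exact_mod_cast hKM)
  have hb := hβ i
  rw [achievableRate, lintegral_inv_sinr hKM hσ hβ hlaw hindep hp,
    ← ENNReal.ofReal_inv_of_pos (by positivity), ENNReal.toReal_ofReal (by positivity), inv_div]

/-- The SINR is identically 0, so its inverse in `ENNReal` is ∞, as is the expectation, whose
inverse is 0. -/
lemma achievableRate_eq_zero [IsProbabilityMeasure μ] {s : Ω → ℂ} {i : Fin K}
    (hp : ulEnergy μ P h s i = 0) : achievableRate μ P h s i = 0 := by
  simp [achievableRate, sinr, hp]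

lemma instRate_eq_zero {s : Ω → ℂ} {i : Fin K} (hp : ulEnergy μ P h s i = 0) :
    instRate μ P h s i = fun _ => 0 := by
  funext ω
  simp [instRate, sinr, hp]

/-- The ergodic rate is finite and is bounded below by the achievable rate. -/
lemma achievableRate_le_ergodicRate_of_pos [IsProbabilityMeasure μ] (hKM : K < M) (hB : 0 < P.B)
    (hWIT : 0 < P.αWIT) (hσ : 0 < P.σ2) (hβ : ∀ i, 0 < P.β i)
    (hlaw : ∀ i j, HasLaw (h i j) stdComplexGaussian μ)
    (hindep : iIndepFun (fun q : Fin K × Fin M => h q.1 q.2) μ) {s : Ω → ℂ} {i : Fin K}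
    (hp : 0 < ulEnergy μ P h s i) :
    Integrable (instRate μ P h s i) μ ∧ achievableRate μ P h s i ≤ ergodicRate μ P h s i := by
  have hMK : (0 : ℝ) < (M : ℝ) - K := sub_pos.2 (by exact_mod_cast hKM)
  have hb := hβ i
  have hl : 0 < Real.log 2 := Real.log_pos one_lt_two
  have hli := ae_linearIndependent_chan hKM hβ hlaw hindep
  have hach := achievableRate_eq_of_pos hKM hσ hβ hlaw hindep hp
  set p := ulEnergy μ P h s
  set Y : Ω → ℝ := fun ω => P.σ2 / p i * ‖zfVector P h i ω‖ ^ 2 with hYdef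
  have hzm := (aemeasurable_zfVector (P := P) hlaw hindep i).norm.pow_const 2
  have hYm : AEMeasurable Y μ := hzm.const_mul _
  have hzlint := lintegral_zfVector hKM hβ hlaw hindep i
  have hzi : Integrable (fun ω => ‖zfVector P h i ω‖ ^ 2) μ :=
    (lintegral_ofReal_ne_top_iff_integrable hzm.aestronglyMeasurable
      (ae_of_all _ fun ω => sq_nonneg _)).1 (hzlint.trans_ne ENNReal.ofReal_ne_top)
  have hYi : Integrable Y μ := hzi.const_mul _
  have hYv : ∫ ω, Y ω ∂μ = P.σ2 / (p i * P.β i * ((M : ℝ) - K)) := by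
    rw [hYdef, integral_const_mul, integral_eq_lintegral_of_nonneg_ae
      (ae_of_all _ fun ω => sq_nonneg _) hzm.aestronglyMeasurable, hzlint,
      ENNReal.toReal_ofReal (by positivity), div_mul_div_comm, mul_one, mul_assoc]
  have hsinr : ∀ᵐ ω ∂μ, sinr P h p i ω = (Y ω)⁻¹ := by
    filter_upwards [hli] with ω hω
    exact sinr_eq P h p ω hω i
  have hYpos : ∀ᵐ ω ∂μ, 0 < Y ω := by
    filter_upwards [hli] with ω hω
    have h1 := one_le_norm_zfVector_mul P h ω hω i
    have hz : 0 < ‖zfVector P h i ω‖ := (norm_nonneg _).lt_of_ne fun hz => by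
      rw [← hz, zero_mul] at h1
      linarith
    positivity
  -- Domination: log(1 + 1/Y) ≤ 1/Y ≤ (pᵢ/σ²)‖gᵢ‖², which is integrable.
  have hlog : Integrable (fun ω => Real.logb 2 (1 + (Y ω)⁻¹)) μ := by
    refine ((integrable_norm_chan_sq (P := P) hlaw i).const_mul (p i / P.σ2 / Real.log 2)).mono'
      ?_ ?_
    · exact (((hYm.inv.const_add 1).log).div_const _).aestronglyMeasurable
    · filter_upwards [hli, hYpos] with ω hω hY
      have hinv : 0 < (Y ω)⁻¹ := inv_pos.2 hY
      have h1 := one_le_norm_zfVector_mul P h ω hω i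
      have h2 : (Y ω)⁻¹ ≤ p i / P.σ2 * ‖chan P h i ω‖ ^ 2 := by
        have hz : 0 < ‖zfVector P h i ω‖ ^ 2 := pos_of_mul_pos_right hY (by positivity)
        rw [hYdef, mul_inv, inv_div]
        refine mul_le_mul_of_nonneg_left ((inv_le_iff_one_le_mul₀' hz).2 ?_) (by positivity)
        rw [← mul_pow]
        exact one_le_pow₀ h1
      rw [Real.norm_of_nonneg (Real.logb_nonneg one_lt_two (by linarith)), Real.logb,
        div_mul_eq_mul_div]
      refine div_le_div_of_nonneg_right ?_ hl.le
      have := Real.log_le_sub_one_of_pos (x := 1 + (Y ω)⁻¹) (by linarith)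
      linarith
  have hrate : instRate μ P h s i =ᵐ[μ]
      fun ω => P.αWIT * P.B * Real.logb 2 (1 + (Y ω)⁻¹) := by
    filter_upwards [hsinr] with ω hω
    rw [instRate, hω]
  refine ⟨(hlog.const_mul _).congr hrate.symm, ?_⟩
  rw [hach, ergodicRate, integral_congr_ae hrate, integral_const_mul]
  refine mul_le_mul_of_nonneg_left ?_ (by positivity)
  have hJ := logb_one_add_inv_integral_le hYi hYpos (by rw [hYv]; positivity) hlog
  rwa [hYv, inv_div] at hJ

end Uplink

/-! ### Harvester regimes and antenna thresholds -/

section Harvesting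

variable {K : ℕ} {P : Params K}

lemma harvest_eq_zero (hB : 0 < P.B) (hθ : P.θact ≤ P.θsat) {γ : ℝ} (hγ : γ < P.θact / P.B) :
    harvest P γ = 0 := by
  have : P.θact / P.B ≤ P.θsat / P.B := div_le_div_of_nonneg_right hθ hB.le
  rw [harvest, Set.indicator_of_notMem (fun h => absurd h.1 (not_le.2 hγ)),
    Set.indicator_of_notMem (s := Set.Ici _) (not_le.2 (hγ.trans_le this)), add_zero]

lemma harvest_eq_linear {γ : ℝ} (h1 : P.θact / P.B ≤ γ) (h2 : γ < P.θsat / P.B) :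
    harvest P γ = P.ηEH * γ := by
  rw [harvest, Set.indicator_of_mem (Set.mem_Ico.2 ⟨h1, h2⟩),
    Set.indicator_of_notMem (s := Set.Ici _) (not_le.2 h2), add_zero]

lemma harvest_eq_saturated {γ : ℝ} (h : P.θsat / P.B ≤ γ) :
    harvest P γ = P.ηEH * P.θsat / P.B := by
  rw [harvest, Set.indicator_of_notMem (fun h' => absurd h'.2 (not_lt.2 h)),
    Set.indicator_of_mem (Set.mem_Ici.2 h), zero_add]

/-- The number of antennas is below `antennaThreshold P θ i` exactly when the received power of
user `i` is below `θ`. -/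
lemma lt_antennaThreshold_iff {M : ℕ} (hB : 0 < P.B) (hWET : 0 < P.αWET) (hpdl : 0 < P.pdl)
    (hζ : ∀ i, 0 < P.ζ i) (hβ : ∀ i, 0 < P.β i) (θ : ℝ) (i : Fin K) :
    (M : ℤ) < antennaThreshold P θ i ↔
      P.αWET * P.pdl * P.β i * (P.ζ i * (M : ℝ) + (1 - P.ζ i)) < θ / P.B := by
  have hz := hζ i
  have hb := hβ i
  have hPdl : 0 < P.Pdl := by unfold Params.Pdl; positivity
  -- An integer lies below ⌈x⌉ exactly when it lies below x, so the rounding loses nothing.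
  rw [antennaThreshold, Int.lt_ceil, Int.cast_natCast, ← sub_lt_iff_lt_add', one_div,
    ← div_eq_inv_mul, lt_div_iff₀ hz, lt_sub_iff_add_lt, lt_div_iff₀ (by positivity),
    lt_div_iff₀ hB, Params.Pdl]
  ring_nf

end Harvesting

end WirelessPower

/-! ### Assembly of the three regimes -/

theorem mainTheorem6 {M K : ℕ} (hKM : K < M)
    {Ω : Type*} [MeasurableSpace Ω] (μ : Measure Ω) [IsProbabilityMeasure μ]
    (P : WirelessPower.Params K)
    (hB : 0 < P.B) (hWET : 0 < P.αWET) (hWIT : 0 < P.αWIT) (hα : P.αWET + P.αWIT < 1)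
    (hpdl : 0 < P.pdl) (hσ : 0 < P.σ2)
    (hθact : 0 < P.θact) (hθ : P.θact ≤ P.θsat)
    (hηEH : P.ηEH ∈ Set.Ioc (0 : ℝ) 1) (hηPA : P.ηPA ∈ Set.Ioc (0 : ℝ) 1)
    (hζ : ∀ i, 0 < P.ζ i) (hζsum : ∑ i, P.ζ i = 1)
    (hβ : ∀ i, 0 < P.β i) (hξ : ∀ i, P.ξ i ∈ Set.Ioo (0 : ℝ) 1)
    -- i.i.d. Rayleigh fading: the coefficients are independent with law `CN(0,1)`
    (h : Fin K → Fin M → Ω → ℂ)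
    (hlaw : ∀ i j, HasLaw (h i j) WirelessPower.stdComplexGaussian μ)
    (hindep : iIndepFun (fun q : Fin K × Fin M => h q.1 q.2) μ)
    -- the downlink energy symbol, independent of the channel
    (s : Ω → ℂ) (hs : AEMeasurable s μ) (hspow : ∫ ω, ‖s ω‖ ^ 2 ∂μ = P.pdl)
    (hsindep : IndepFun s (fun ω (q : Fin K × Fin M) => h q.1 q.2 ω) μ)
    (i : Fin K) :
    -- the average received energy
    (Integrable (fun ω => ‖WirelessPower.rxSignal P h s i ω‖ ^ 2) μ ∧
      WirelessPower.rxEnergy μ P h s i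
        = P.αWET * P.pdl * P.β i * (P.ζ i * (M : ℝ) + (1 - P.ζ i))) ∧
    -- the achievable rate is a lower bound on the ergodic rate
    (Integrable (WirelessPower.instRate μ P h s i) μ ∧
      WirelessPower.achievableRate μ P h s i ≤ WirelessPower.ergodicRate μ P h s i) ∧
    -- its value in the three regimes
    ((M : ℤ) < WirelessPower.Mact P i → WirelessPower.achievableRate μ P h s i = 0) ∧
    (WirelessPower.Mact P i ≤ (M : ℤ) → (M : ℤ) < WirelessPower.Msat P i →
      WirelessPower.achievableRate μ P h s i
        = P.αWIT * P.B * Real.logb 2 (1 + (1 - P.ξ i) * P.β i * P.ηPA *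
            (P.ηEH * WirelessPower.rxEnergy μ P h s i / (P.αWIT * P.σ2)) *
            ((M : ℝ) - (K : ℝ)))) ∧
    (WirelessPower.Msat P i ≤ (M : ℤ) →
      WirelessPower.achievableRate μ P h s i
        = P.αWIT * P.B * Real.logb 2 (1 + (1 - P.ξ i) * P.β i * P.ηPA *
            (P.ηEH * P.θsat / (P.B * P.αWIT * P.σ2)) * ((M : ℝ) - (K : ℝ)))) ∧
    -- equal energy allocation, linear regime
    (P.ζ i = 1 / (K : ℝ) → WirelessPower.Mact P i ≤ (M : ℤ) → (M : ℤ) < WirelessPower.Msat P i →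
      WirelessPower.achievableRate μ P h s i
        = P.αWIT * P.B * Real.logb 2 (1 + WirelessPower.rho P i * ((M : ℝ) - (K : ℝ)) *
            (1 + ((M : ℝ) - 1) / (K : ℝ)))) ∧
    WirelessPower.rho P i
      = P.Pdl * (1 - P.ξ i) * P.ηEH * P.ηPA * P.β i ^ 2 / (P.B * P.αWIT * P.σ2) := by
  have hMK : (0 : ℝ) < (M : ℝ) - K := sub_pos.2 (by exact_mod_cast hKM)
  have hK : (0 : ℝ) < K := by exact_mod_cast i.pos
  have hb := hβ i
  have hz := hζ i
  have hξ' : 0 < 1 - P.ξ i := sub_pos.2 (hξ i).2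
  have hEH := hηEH.1
  have hPA := hηPA.1
  have hθsat := hθact.trans_le hθ
  obtain ⟨hint, hγ⟩ :=
    WirelessPower.rxEnergy_eq hKM hpdl hζ hζsum hβ hlaw hindep hspow hsindep i
  have hact := WirelessPower.lt_antennaThreshold_iff (M := M) hB hWET hpdl hζ hβ P.θact i
  have hsat := WirelessPower.lt_antennaThreshold_iff (M := M) hB hWET hpdl hζ hβ P.θsat i
  rw [← hγ] at hact hsat
  set γ := WirelessPower.rxEnergy μ P h s i
  have hlow : γ < P.θact / P.B → WirelessPower.ulEnergy μ P h s i = 0 := fun h1 => by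
    rw [WirelessPower.ulEnergy, WirelessPower.harvest_eq_zero hB hθ h1, mul_zero, zero_div]
  have hlin : P.θact / P.B ≤ γ → γ < P.θsat / P.B →
      WirelessPower.ulEnergy μ P h s i = P.ηPA * (1 - P.ξ i) * (P.ηEH * γ) / P.αWIT :=
    fun h1 h2 => by rw [WirelessPower.ulEnergy, WirelessPower.harvest_eq_linear h1 h2]
  have hhigh : P.θsat / P.B ≤ γ → WirelessPower.ulEnergy μ P h s i
      = P.ηPA * (1 - P.ξ i) * (P.ηEH * P.θsat / P.B) / P.αWIT := fun h1 => by
    rw [WirelessPower.ulEnergy, WirelessPower.harvest_eq_saturated h1]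
  have hlin_pos : P.θact / P.B ≤ γ → γ < P.θsat / P.B →
      0 < WirelessPower.ulEnergy μ P h s i := fun h1 h2 => by
    have : 0 < γ := (div_pos hθact hB).trans_le h1
    rw [hlin h1 h2]
    positivity
  have hhigh_pos : P.θsat / P.B ≤ γ → 0 < WirelessPower.ulEnergy μ P h s i := fun h1 => by
    rw [hhigh h1]
    positivity
  have hrate_lin : WirelessPower.Mact P i ≤ (M : ℤ) → (M : ℤ) < WirelessPower.Msat P i →
      WirelessPower.achievableRate μ P h s i
        = P.αWIT * P.B * Real.logb 2 (1 + (1 - P.ξ i) * P.β i * P.ηPA *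
            (P.ηEH * γ / (P.αWIT * P.σ2)) * ((M : ℝ) - (K : ℝ))) := fun h1 h2 => by
    have h1' := not_lt.1 (mt hact.2 (not_lt.2 h1))
    have h2' := hsat.1 h2
    rw [WirelessPower.achievableRate_eq_of_pos hKM hσ hβ hlaw hindep (hlin_pos h1' h2'),
      hlin h1' h2']
    congr 3
    field_simp
  refine ⟨⟨hint, hγ⟩, ?_, fun h1 => ?_, hrate_lin, fun h1 => ?_, fun hζK h1 h2 => ?_, ?_⟩
  -- Below activation both rates are 0; otherwise the symbol energy is positive and Jensen applies.
  · rcases lt_or_ge γ (P.θact / P.B) with h1 | h1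
    · rw [WirelessPower.ergodicRate, WirelessPower.instRate_eq_zero (hlow h1),
        WirelessPower.achievableRate_eq_zero (hlow h1)]
      simp
    · refine WirelessPower.achievableRate_le_ergodicRate_of_pos hKM hB hWIT hσ hβ hlaw hindep ?_
      rcases lt_or_ge γ (P.θsat / P.B) with h2 | h2
      · exact hlin_pos h1 h2
      · exact hhigh_pos h2
  · exact WirelessPower.achievableRate_eq_zero (hlow (hact.1 h1))
  · have h1' := not_lt.1 (mt hsat.2 (not_lt.2 h1))
    rw [WirelessPower.achievableRate_eq_of_pos hKM hσ hβ hlaw hindep (hhigh_pos h1'), hhigh h1']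
    congr 3
    field_simp
  -- For ζᵢ = 1/K the gain ζᵢM + 1 - ζᵢ equals 1 + (M - 1)/K; the second factor β i in `rho` comes
  -- from the received energy.
  · rw [hrate_lin h1 h2, hγ, hζK, WirelessPower.rho]
    congr 3
    field_simp
    ring
  · rw [WirelessPower.rho, WirelessPower.Params.Pdl]
    field_simp
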